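/- Write points of $\mathbb{R}^{2d}$ as $z=(x,\omega)$ with $x,\omega\in\mathbb{R}^d$, and let $\pi(x,\omega)f(t)=e^{2\pi i\omega\cdot t}f(t-x)$ be the time-frequency shifts, extended to tempered distributions. For $1\le p,q\le\infty$ let $$\|F\|_{L^{p,q}(\mathbb{R}^{2d})}=\Big(\int_{\mathbb{R}^d}\Big(\int_{\mathbb{R}^d}|F(x,\omega)|^p\,dx\Big)^{q/p}d\omega\Big)^{1/q}$$ (with essential suprema for infinite exponents), and let $L^{p,q}(\mathbb{R}^{2d})$ be the space of measurable $F:\mathbb{R}^{2d}\to\mathbb{C}$ for which this is finite. Fix a nonzero Schwartz function $g$ on $\mathbb{R}^d$. For a tempered distribution $\psi$ put $V_g\psi(z)=\langle\psi,\pi(z)g\rangle$ (brackets conjugate-linear in the second argument) and $\|\psi\|_{M^{p,q}}=\|V_g\psi\|_{L^{p,q}}$; the modulation space $M^{p,q}(\mathbb{R}^d)$ consists of the tempered distributions with $\|\psi\|_{M^{p,q}}<\infty$, and $M^1=M^{1,1}$. For a window $\varphi\in M^1(\mathbb{R}^d)$ and $\psi$ in some $M^{q_1,q_2}(\mathbb{R}^d)$,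 $1\le q_1,q_2\le\infty$, put $V_\varphi\psi(z)=\langle\psi,\pi(z)\varphi\rangle$, where the bracket is the duality pairing $$\langle\psi,u\rangle=\|h\|_{L^2}^{-2}\int_{\mathbb{R}^{2d}}V_h\psi(w)\,\overline{V_hu(w)}\,dw,\qquad u\in M^1(\mathbb{R}^d),$$ computed with any nonzero Schwartz function $h$; it extends the inner product of $L^2(\mathbb{R}^d)$. For $\mu:\mathbb{R}^{2d}\to\mathbb{C}$ the time-frequency blurring operator is $$B_\mu^\varphi\psi=V_\varphi^*(\mu*V_\varphi\psi)=\int_{\mathbb{R}^{2d}}(\mu*V_\varphi\psi)(z)\,\pi(z)\varphi\,dz,$$ with the integral over $z$ understood weakly, i.e. tested against Schwartz functions. Let $1\le p_i,q_i,r_i\le\infty$ with $\frac1{p_i}+\frac1{q_i}=1+\frac1{r_i}$ for $i=1,2$, and let $\varphi\in M^1(\mathbb{R}^d)$. Then there is a constant $C$, depending only on $d$, $\varphi$, the exponents $p_i,q_i,r_i$ and the window $g$ used for the norms, such that for all $\mu\in L^{p_1,p_2}(\mathbb{R}^{2d})$ and all $\psi\in M^{q_1,q_2}(\mathbb{R}^d)$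 the following holds. The pairings $V_\varphi\psi(z)$ converge absolutely for every $z$, the convolution $\mu*V_\varphi\psi$ converges absolutely almost everywhere, and the weak integral converges absolutely and defines a tempered distribution $B_\mu^\varphi\psi$, which does not depend on $h$. Moreover $B_\mu^\varphi\psi\in M^{r_1,r_2}(\mathbb{R}^d)$ and $$\|B_\mu^\varphi\psi\|_{M^{r_1,r_2}(\mathbb{R}^d)}\le C\,\|\mu\|_{L^{p_1,p_2}(\mathbb{R}^{2d})}\,\|\psi\|_{M^{q_1,q_2}(\mathbb{R}^d)}.$$ -/

import Mathlib

open MeasureTheory SchwartzMap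
open scoped ENNReal NNReal ComplexConjugate RealInnerProductSpace Convolution

noncomputable section

namespace TFBlur

/-- The signal domain `ℝᵈ` with its Euclidean structure. Phase space `ℝ²ᵈ` is the product
`RR d × RR d`, whose points are written `(x, ω)` (time, frequency); its `volume` is Lebesgue
measure. -/
abbrev RR (d : ℕ) : Type := EuclideanSpace ℝ (Fin d)

variable {d : ℕ}

/-! ### Time-frequency shifts of Schwartz functions and of tempered distributions -/

/-- The character `t ↦ e^{2π i ω · t}`. -/
def character (ω : RR d) (t : RR d) : ℂ :=
  Complex.exp (2 * (Real.pi : ℂ) * Complex.I * ((inner ℝ ω t : ℝ) : ℂ))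

theorem iteratedDeriv_cexp_real (c : ℂ) (n : ℕ) :
    iteratedDeriv n (fun s : ℝ => Complex.exp (c * (s : ℂ))) =
      fun s : ℝ => c ^ n * Complex.exp (c * (s : ℂ)) := by
  induction n with
  | zero => funext s; simp
  | succ n ih =>
    rw [iteratedDeriv_succ, ih]
    funext s
    have h1 : HasDerivAt (fun s : ℝ => c * (s : ℂ)) c s := by
      simpa using (Complex.ofRealCLM.hasDerivAt (x := s)).const_mul c
    have h2 := (h1.cexp.const_mul (c ^ n)).deriv
    rw [h2]; ring

theorem hasTemperateGrowth_character (ω : RR d) : (character ω).HasTemperateGrowth := by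
  have h1 : Function.HasTemperateGrowth
      (fun s : ℝ => Complex.exp (2 * (Real.pi : ℂ) * Complex.I * (s : ℂ))) := by
    refine ⟨?_, fun n => ⟨0, (2 * Real.pi) ^ n, fun s => ?_⟩⟩
    · exact (contDiff_const.mul Complex.ofRealCLM.contDiff).cexp
    rw [norm_iteratedFDeriv_eq_norm_iteratedDeriv, iteratedDeriv_cexp_real]
    simp [Complex.norm_exp, abs_of_pos Real.pi_pos]
  exact h1.comp (Function.hasTemperateGrowth_inner_right ω)

/-- The time-frequency shift `π(x, ω) f (t) = (M_ω T_x f)(t) = e^{2π i ω · t} f(t - x)` of a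
Schwartz function. -/
def shift (z : RR d × RR d) : 𝓢(RR d, ℂ) →L[ℂ] 𝓢(RR d, ℂ) :=
  SchwartzMap.smulLeftCLM ℂ (character z.2) ∘L SchwartzMap.compSubConstCLM ℂ z.1

theorem shift_apply (z : RR d × RR d) (f : 𝓢(RR d, ℂ)) (t : RR d) :
    shift z f t = character z.2 t * f (t - z.1) := by
  simp [shift, SchwartzMap.smulLeftCLM_apply_apply (hasTemperateGrowth_character z.2)]

/-- The complex conjugate of a Schwartz function. -/
def conjS (f : 𝓢(RR d, ℂ)) : 𝓢(RR d, ℂ) :=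
  SchwartzMap.postcompCLM (𝕜 := ℝ) (Complex.conjCLE : ℂ →L[ℝ] ℂ) f

theorem conjS_apply (f : 𝓢(RR d, ℂ)) (t : RR d) : conjS f t = conj (f t) := rfl

/-- The time-frequency shift `π(x, ω) u` of a tempered distribution `u`; on functions it is again
`e^{2π i ω · t} u(t - x)`, since
`∫ e^{2π i ω · t} u(t - x) f(t) dt = ∫ u(s) e^{2π i ω · (s + x)} f(s + x) ds`. -/
def shiftD (z : RR d × RR d) (u : 𝓢'(RR d, ℂ)) : 𝓢'(RR d, ℂ) :=
  TemperedDistribution.smulLeftCLM ℂ (character z.2)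
    (PointwiseConvergenceCLM.precomp ℂ (SchwartzMap.compSubConstCLM ℂ (-z.1)) u)

theorem shiftD_apply (z : RR d × RR d) (u : 𝓢'(RR d, ℂ)) (f : 𝓢(RR d, ℂ)) :
    shiftD z u f =
      u (SchwartzMap.compSubConstCLM ℂ (-z.1)
        (SchwartzMap.smulLeftCLM ℂ (character z.2) f)) := rfl

/-- Consistency of the two notions of time-frequency shift: on Schwartz functions, viewed as
tempered distributions, they agree. -/
theorem shiftD_coe (z : RR d × RR d) (u : 𝓢(RR d, ℂ)) :
    shiftD z (u : 𝓢'(RR d, ℂ)) = (shift z u : 𝓢(RR d, ℂ)) := by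
  ext f
  have hc := hasTemperateGrowth_character z.2
  have hu := SchwartzMap.coe_apply (F := ℂ) u (SchwartzMap.compSubConstCLM ℂ (-z.1)
    (SchwartzMap.smulLeftCLM ℂ (character z.2) f))
  rw [shiftD_apply, hu, SchwartzMap.coe_apply (F := ℂ) (shift z u) f,
    ← integral_sub_right_eq_self _ z.1]
  refine integral_congr_ae (Filter.Eventually.of_forall fun t => ?_)
  simp [shift_apply, SchwartzMap.smulLeftCLM_apply_apply hc]
  ring

/-! ### Mixed-norm Lebesgue spaces -/

/-- The mixed norm `‖F‖_{L^{p,q}}` on `ℝ²ᵈ`: the `p`-norm in the first `d` variables, then the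
`q`-norm in the remaining `d` variables (an essential supremum for an infinite exponent). -/
def mixedNorm (p q : ℝ≥0∞) (F : RR d × RR d → ℂ) : ℝ≥0∞ :=
  eLpNorm (fun ω : RR d => eLpNorm (fun x : RR d => F (x, ω)) p volume) q volume

/-- `F ∈ L^{p,q}(ℝ²ᵈ)`. -/
def MemMixed (p q : ℝ≥0∞) (F : RR d × RR d → ℂ) : Prop :=
  AEStronglyMeasurable F volume ∧ mixedNorm p q F < ∞

/-! ### Short-time Fourier transform and modulation spaces -/

/-- The short-time Fourier transform `V_g ψ (z) = ⟨ψ, π(z) g⟩` of a tempered distribution `ψ` with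
respect to a Schwartz window `g`. -/
def stft (g : 𝓢(RR d, ℂ)) (ψ : 𝓢'(RR d, ℂ)) (z : RR d × RR d) : ℂ :=
  ψ (conjS (shift z g))

/-- The norm `‖ψ‖_{M^{p,q}} = ‖V_g ψ‖_{L^{p,q}}`, computed with the Schwartz window `g`. -/
def modNorm (g : 𝓢(RR d, ℂ)) (p q : ℝ≥0∞) (ψ : 𝓢'(RR d, ℂ)) : ℝ≥0∞ :=
  mixedNorm p q (stft g ψ)

/-- `ψ ∈ M^{p,q}(ℝᵈ)`, tested with the Schwartz window `g`. -/
def MemMod (g : 𝓢(RR d, ℂ)) (p q : ℝ≥0∞) (ψ : 𝓢'(RR d, ℂ)) : Prop :=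
  modNorm g p q ψ < ∞

/-! ### The short-time Fourier transform with a window in `M¹` -/

/-- The integrand of the duality pairing `⟨ψ, u⟩` between `M^∞` and `M¹`. -/
def pairingIntegrand (h : 𝓢(RR d, ℂ)) (ψ u : 𝓢'(RR d, ℂ)) (w : RR d × RR d) : ℂ :=
  stft h ψ w * conj (stft h u w)

/-- The (sesquilinear) duality pairing
`⟨ψ, u⟩ = ‖h‖_{L²}⁻² ∫ V_h ψ(w) conj (V_h u(w)) dw` of `ψ ∈ M^{q₁,q₂} ⊆ M^∞` and `u ∈ M¹`,
computed with the nonzero Schwartz function `h`. By Moyal's identity it extends the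
inner product of `L²`. -/
def pairing (h : 𝓢(RR d, ℂ)) (ψ u : 𝓢'(RR d, ℂ)) : ℂ :=
  (((∫ t, ‖h t‖ ^ 2 : ℝ) : ℂ))⁻¹ * ∫ w, pairingIntegrand h ψ u w

/-- The short-time Fourier transform `V_φ ψ (z) = ⟨ψ, π(z) φ⟩` for a window `φ ∈ M¹` and a
tempered distribution `ψ` in a modulation space. -/
def stftM (h : 𝓢(RR d, ℂ)) (φ ψ : 𝓢'(RR d, ℂ)) (z : RR d × RR d) : ℂ :=
  pairing h ψ (shiftD z φ)

/-! ### Time-frequency blurring operators -/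

/-- `(μ * V_φ ψ)(z)`. -/
def blurredStft (h : 𝓢(RR d, ℂ)) (μ : RR d × RR d → ℂ) (φ ψ : 𝓢'(RR d, ℂ)) :
    RR d × RR d → ℂ :=
  μ ⋆[ContinuousLinearMap.mul ℂ ℂ, volume] stftM h φ ψ

/-- `B = B_μ^φ ψ = V_φ^* (μ * V_φ ψ) = ∫ (μ * V_φ ψ)(z) π(z) φ dz`, the last integral being read
weakly, i.e. tested against Schwartz functions. All the integrals in the definition are required
to converge absolutely (the convolution at almost every point). These conditions determine `B`. -/
structure IsBlur (h : 𝓢(RR d, ℂ)) (μ : RR d × RR d → ℂ) (φ ψ B : 𝓢'(RR d, ℂ)) : Prop where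
  pairing_integrable : ∀ z, Integrable (pairingIntegrand h ψ (shiftD z φ)) volume
  convolution_exists : ∀ᵐ z : RR d × RR d,
    ConvolutionExistsAt μ (stftM h φ ψ) z (ContinuousLinearMap.mul ℂ ℂ) volume
  synthesis_integrable : ∀ f : 𝓢(RR d, ℂ),
    Integrable (fun z => blurredStft h μ φ ψ z * shiftD z φ f) volume
  apply_eq : ∀ f : 𝓢(RR d, ℂ), B f = ∫ z, blurredStft h μ φ ψ z * shiftD z φ f

end TFBlur

end

/-!
The theorem rests on three facts about the short-time Fourier transform with a Schwartz window `g`.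

*Inversion.* For a tempered distribution `ψ` and a Schwartz function `f`, the Schwartz functions
`conj ⟨f, π(z) g⟩ conj (π(z) g)` have integrable seminorms and their integral over phase space is
`‖g‖² conj f`. A tempered distribution factors through finitely many seminorms, so it passes through
this integral (`integral_apply_schwartz`), which gives
`∫ V_g ψ(z) conj (V_g f(z)) dz = ‖g‖² ⟨ψ, f⟩` (`integral_stft_mul_conj_stft`). Since `V_g f` decays
rapidly, with bounds by seminorms of `f`, Hölder's inequality for mixed norms yields
`M^{p,q} ⊆ M^∞`. The formula also shows that Schwartz windows other than `g` give integrable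
transforms for elements of `M¹` and, with Fubini's theorem, that the duality pairing does not depend
on the window (`pairing_eq_pairing`).

*Covariance.* `|V_g (π(z) φ)(w)| = |V_g φ(w - z)|` (`stft_shiftD`). Hence the pairing with `π(z) φ`
and the synthesis integral are dominated by convolutions:
`|V_φ ψ| ≤ ‖g‖⁻² |V_g ψ| * |V_g φ|^∨` (`enorm_stftM_le`), and, for `B = ∫ K(z) π(z) φ dz`,
`|V_g B| ≤ |K| * |V_g φ|` (`exists_synthesis`).

*Young's inequality* for mixed norms (`mixedENorm_lconvolution_le`). It follows from the inequality
on each factor of phase space together with Minkowski's integral inequality.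

With `K = μ * V_φ ψ`, three applications of Young's inequality, with exponents `(q, 1) → q`,
`(p, q) → r` and `(r, 1) → r`, give the norm bound with constant `‖g‖⁻² ‖φ‖²` (norms in `L²` and in
`M¹`). The same majorants give the absolute convergence of all integrals. The weak integral is
continuous in the test function `f` because `|⟨π(z) φ, f⟩|` is again dominated by a convolution with
the rapidly decreasing function `V_g (conj f)` (`exists_lintegral_synthesis_le`).
-/

open MeasureTheory SchwartzMap
open scoped ENNReal NNReal ComplexConjugate RealInnerProductSpace Convolution

noncomputable section

namespace TFBlur

/-! ### Lebesgue norms of `ℝ≥0∞`-valued functions -/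

section ENNRealNorms

variable {α β : Type*} [MeasurableSpace α] [MeasurableSpace β] {μ : Measure α} {ν : Measure β}

theorem rpow_eLpNorm_toReal {p : ℝ≥0∞} (h0 : p ≠ 0) (ht : p ≠ ∞) (f : α → ℝ≥0∞) :
    eLpNorm f p μ ^ p.toReal = ∫⁻ x, f x ^ p.toReal ∂μ := by
  have hp : p.toReal ≠ 0 := (ENNReal.toReal_pos h0 ht).ne'
  rw [eLpNorm_eq_lintegral_rpow_enorm_toReal h0 ht, ← ENNReal.rpow_mul, one_div,
    inv_mul_cancel₀ hp, ENNReal.rpow_one]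
  simp

theorem ae_le_eLpNorm_top (f : α → ℝ≥0∞) : ∀ᵐ x ∂μ, f x ≤ eLpNorm f ∞ μ := by
  rw [eLpNorm_exponent_top]
  exact ae_le_eLpNormEssSup (f := f)

theorem eLpNorm_top_le {f : α → ℝ≥0∞} {c : ℝ≥0∞} (h : ∀ᵐ x ∂μ, f x ≤ c) : eLpNorm f ∞ μ ≤ c := by
  rw [eLpNorm_exponent_top]
  exact essSup_le_of_ae_le c h

theorem eLpNorm_one_eq_lintegral (f : α → ℝ≥0∞) : eLpNorm f 1 μ = ∫⁻ x, f x ∂μ := by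
  simp [eLpNorm_one_eq_lintegral_enorm]

theorem eLpNorm_mono_fun {f g : α → ℝ≥0∞} (p : ℝ≥0∞) (h : ∀ x, f x ≤ g x) :
    eLpNorm f p μ ≤ eLpNorm g p μ :=
  eLpNorm_mono_enorm h

theorem eLpNorm_mono_fun_ae {f g : α → ℝ≥0∞} (p : ℝ≥0∞) (h : ∀ᵐ x ∂μ, f x ≤ g x) :
    eLpNorm f p μ ≤ eLpNorm g p μ :=
  eLpNorm_mono_enorm_ae h

/-- Multiplication by a constant. No finiteness of the constant is needed when the function is
measurable. -/
theorem eLpNorm_const_mul {p : ℝ≥0∞} (hp : 1 ≤ p) {f : α → ℝ≥0∞} (hf : Measurable f)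
    (c : ℝ≥0∞) : eLpNorm (fun x => c * f x) p μ ≤ c * eLpNorm f p μ := by
  rcases eq_or_ne p ∞ with rfl | ht
  · refine eLpNorm_top_le ?_
    filter_upwards [ae_le_eLpNorm_top f] with x hx
    gcongr
  · have h0 : p ≠ 0 := (zero_lt_one.trans_le hp).ne'
    have hP : 0 < p.toReal := ENNReal.toReal_pos h0 ht
    rw [← ENNReal.rpow_le_rpow_iff hP, ENNReal.mul_rpow_of_nonneg _ _ hP.le,
      rpow_eLpNorm_toReal h0 ht, rpow_eLpNorm_toReal h0 ht,
      ← lintegral_const_mul _ (hf.pow_const _)]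
    refine lintegral_mono fun x => ?_
    rw [ENNReal.mul_rpow_of_nonneg _ _ hP.le]

theorem measurable_eLpNorm_section [SFinite μ] (p : ℝ≥0∞) {F : α × β → ℝ≥0∞}
    (hF : Measurable F) : Measurable fun y => eLpNorm (fun x => F (x, y)) p μ := by
  rcases eq_or_ne p 0 with rfl | h0
  · simp
  rcases eq_or_ne p ∞ with rfl | ht
  · refine measurable_of_Iic fun c => ?_
    have hset : MeasurableSet {z : α × β | ¬ F z ≤ c} :=
      (measurableSet_le hF measurable_const).compl
    have hm := measurable_measure_prodMk_right (μ := μ) hset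
    convert hm (measurableSet_singleton 0) using 1
    ext y
    simp only [Set.mem_preimage, Set.mem_Iic, Set.mem_singleton_iff]
    constructor
    · intro h
      have := ae_le_eLpNorm_top (μ := μ) fun x => F (x, y)
      exact ae_iff.mp (this.mono fun x hx => hx.trans h)
    · intro h
      exact eLpNorm_top_le (ae_iff.mpr h)
  · simp_rw [eLpNorm_eq_lintegral_rpow_enorm_toReal h0 ht, enorm_eq_self]
    exact (Measurable.lintegral_prod_left' (hF.pow_const _)).pow_const _

/-- Hölder's inequality. -/
theorem lintegral_mul_le_eLpNorm_mul_eLpNorm {p q : ℝ≥0∞} (hpq : p⁻¹ + q⁻¹ = 1)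
    {f g : α → ℝ≥0∞} (hf : AEMeasurable f μ) (hg : AEMeasurable g μ) :
    ∫⁻ x, f x * g x ∂μ ≤ eLpNorm f p μ * eLpNorm g q μ := by
  have aux : ∀ {u v : α → ℝ≥0∞}, AEMeasurable u μ →
      ∫⁻ x, u x * v x ∂μ ≤ eLpNorm u 1 μ * eLpNorm v ∞ μ := by
    intro u v hu
    rw [eLpNorm_one_eq_lintegral, ← lintegral_mul_const'' _ hu]
    refine lintegral_mono_ae ?_
    filter_upwards [ae_le_eLpNorm_top (μ := μ) v] with x hx
    gcongr
  rcases eq_or_ne p ∞ with rfl | hpt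
  · have : q = 1 := by simpa using hpq
    subst this
    simp_rw [mul_comm (f _), mul_comm (eLpNorm f _ _)]
    exact aux hg
  rcases eq_or_ne q ∞ with rfl | hqt
  · have : p = 1 := by simpa using hpq
    subst this
    exact aux hf
  have hp0 : p ≠ 0 := by rintro rfl; simp at hpq
  have hq0 : q ≠ 0 := by rintro rfl; simp at hpq
  have hr : p.toReal⁻¹ + q.toReal⁻¹ = 1 := by
    rw [← ENNReal.toReal_inv, ← ENNReal.toReal_inv, ← ENNReal.toReal_add (by simp [hp0])
      (by simp [hq0]), hpq, ENNReal.toReal_one]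
  have hconj : p.toReal.HolderConjugate q.toReal :=
    Real.HolderTriple.mk (by simpa using hr) (ENNReal.toReal_pos hp0 hpt)
      (ENNReal.toReal_pos hq0 hqt)
  have := ENNReal.lintegral_mul_le_Lp_mul_Lq μ hconj hf hg
  rw [eLpNorm_eq_lintegral_rpow_enorm_toReal hp0 hpt,
    eLpNorm_eq_lintegral_rpow_enorm_toReal hq0 hqt]
  simpa using this

/-- Minkowski's integral inequality. The proof writes
`F(x, y) = (F(x, y)ᵖ a(y)¹⁻ᵖ)^{1/p} a(y)^{1-1/p}`, where `a(y)` is the norm of `F(·, y)`, and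
applies Hölder's inequality in `y`. -/
theorem eLpNorm_lintegral_le [SFinite μ] [SFinite ν] {p : ℝ≥0∞} (hp : 1 ≤ p)
    {F : α × β → ℝ≥0∞} (hF : Measurable F) :
    eLpNorm (fun x => ∫⁻ y, F (x, y) ∂ν) p μ ≤ ∫⁻ y, eLpNorm (fun x => F (x, y)) p μ ∂ν := by
  set a : β → ℝ≥0∞ := fun y => eLpNorm (fun x => F (x, y)) p μ with ha
  have ham : Measurable a := measurable_eLpNorm_section p hF
  have hx : ∀ y, Measurable fun x => F (x, y) := fun y => hF.comp measurable_prodMk_right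
  have hy : ∀ x, Measurable fun y => F (x, y) := fun x => hF.comp measurable_prodMk_left
  rcases eq_or_ne p ∞ with rfl | ht
  · have h1 : ∀ᵐ x ∂μ, ∀ᵐ y ∂ν, F (x, y) ≤ a y := by
      rw [Measure.ae_ae_comm (p := fun x y => F (x, y) ≤ a y)
        (measurableSet_le hF (ham.comp measurable_snd))]
      exact Filter.Eventually.of_forall fun y => ae_le_eLpNorm_top _
    refine eLpNorm_top_le ?_
    filter_upwards [h1] with x hx
    exact lintegral_mono_ae hx
  rcases eq_or_ne (∫⁻ y, a y ∂ν) ∞ with hA | hA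
  · rw [hA]; exact le_top
  have h0 : p ≠ 0 := (zero_lt_one.trans_le hp).ne'
  set P := p.toReal with hP
  have hP1 : 1 ≤ P := by
    have := ENNReal.toReal_mono ht hp
    simpa using this
  have hP0 : 0 < P := by linarith
  have hPi : 0 ≤ 1 - 1 / P := by
    rw [sub_nonneg, div_le_one hP0]; exact hP1
  have hat : ∀ᵐ y ∂ν, a y < ∞ := ae_lt_top ham hA
  -- `a(y)^{1-p}` is infinite where `a(y) = 0`; there `F(·, y)` vanishes almost everywhere.
  have hzero : ∀ᵐ x ∂μ, ∀ᵐ y ∂ν, a y = 0 → F (x, y) = 0 := by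
    have hs : MeasurableSet {z : α × β | a z.2 = 0 → F z = 0} := by
      have : {z : α × β | a z.2 = 0 → F z = 0} = {z | a z.2 = 0}ᶜ ∪ {z | F z = 0} := by
        ext z; simp [imp_iff_not_or]
      rw [this]
      exact ((ham.comp measurable_snd) (measurableSet_singleton 0)).compl.union
        (hF (measurableSet_singleton 0))
    rw [Measure.ae_ae_comm (p := fun x y => a y = 0 → F (x, y) = 0) hs]
    refine Filter.Eventually.of_forall fun y => ?_
    by_cases hay : a y = 0
    · have := (eLpNorm_eq_zero_iff (hx y).aestronglyMeasurable h0).mp hay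
      filter_upwards [this] with x hx _ using hx
    · exact Filter.Eventually.of_forall fun x h => absurd h hay
  have hpt : ∀ᵐ x ∂μ, (∫⁻ y, F (x, y) ∂ν) ^ P ≤
      (∫⁻ y, F (x, y) ^ P * a y ^ (1 - P) ∂ν) * (∫⁻ y, a y ∂ν) ^ (P - 1) := by
    filter_upwards [hzero] with x hx
    have e : ∀ᵐ y ∂ν, F (x, y) ≤ (F (x, y) ^ P * a y ^ (1 - P)) ^ (1 / P) * a y ^ (1 - 1 / P) := by
      filter_upwards [hx, hat] with y h1 h2
      rcases eq_or_ne (a y) 0 with h3 | h3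
      · simp [h1 h3]
      · rw [ENNReal.mul_rpow_of_nonneg _ _ (by positivity), ← ENNReal.rpow_mul, ← ENNReal.rpow_mul,
          mul_assoc, ← ENNReal.rpow_add _ _ h3 h2.ne, mul_one_div_cancel hP0.ne', ENNReal.rpow_one]
        have : (1 - P) * (1 / P) + (1 - 1 / P) = 0 := by field_simp; ring
        rw [this, ENNReal.rpow_zero, mul_one]
    have h4 := (lintegral_mono_ae e).trans (ENNReal.lintegral_mul_norm_pow_le (μ := ν)
      (f := fun y => F (x, y) ^ P * a y ^ (1 - P)) (g := a)
      (((hy x).pow_const _).mul (ham.pow_const _)).aemeasurable ham.aemeasurable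
      (by positivity) hPi (by ring))
    refine (ENNReal.rpow_le_rpow h4 hP0.le).trans_eq ?_
    rw [ENNReal.mul_rpow_of_nonneg _ _ hP0.le, ← ENNReal.rpow_mul, ← ENNReal.rpow_mul,
      one_div_mul_cancel hP0.ne', ENNReal.rpow_one]
    congr 2
    field_simp
  rw [← ENNReal.rpow_le_rpow_iff hP0, rpow_eLpNorm_toReal h0 ht]
  have hm : Measurable fun z : α × β => F z ^ P * a z.2 ^ (1 - P) :=
    (hF.pow_const _).mul ((ham.comp measurable_snd).pow_const _)
  calc ∫⁻ x, (∫⁻ y, F (x, y) ∂ν) ^ P ∂μ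
      ≤ ∫⁻ x, (∫⁻ y, F (x, y) ^ P * a y ^ (1 - P) ∂ν) * (∫⁻ y, a y ∂ν) ^ (P - 1) ∂μ :=
        lintegral_mono_ae hpt
    _ = (∫⁻ y, ∫⁻ x, F (x, y) ^ P * a y ^ (1 - P) ∂μ ∂ν) * (∫⁻ y, a y ∂ν) ^ (P - 1) := by
        rw [lintegral_mul_const _ hm.lintegral_prod_right',
          lintegral_lintegral_swap hm.aemeasurable]
    _ ≤ (∫⁻ y, a y ∂ν) * (∫⁻ y, a y ∂ν) ^ (P - 1) := by
        gcongr with y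
        rw [lintegral_mul_const _ ((hx y).pow_const _), ← rpow_eLpNorm_toReal h0 ht]
        change a y ^ P * a y ^ (1 - P) ≤ a y
        rcases eq_or_ne (a y) 0 with h3 | h3
        · simp [h3, hP0]
        rcases eq_or_ne (a y) ∞ with h4 | h4
        · simp [h4]
        · rw [← ENNReal.rpow_add _ _ h3 h4]; simp
    _ = (∫⁻ y, a y ∂ν) ^ P := by
        conv_rhs => rw [show P = 1 + (P - 1) by ring,
          ENNReal.rpow_add_of_nonneg _ _ zero_le_one (by linarith), ENNReal.rpow_one]

end ENNRealNorms

/-! ### Young's inequality for convolutions -/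

section Young

variable {G : Type*} [AddCommGroup G] [MeasurableSpace G] [MeasurableAdd₂ G] [MeasurableNeg G]
  {μ : Measure G} [μ.IsAddLeftInvariant] [μ.IsNegInvariant]

theorem measurePreserving_neg_add (x : G) : MeasurePreserving (fun y => -y + x) μ μ := by
  have h1 : MeasurePreserving (fun y : G => -y) μ μ := Measure.measurePreserving_neg μ
  have h2 : MeasurePreserving (fun y : G => y + x) μ μ := measurePreserving_add_right μ x
  exact h2.comp h1

/-- Young's inequality for convolutions on a commutative group. -/
theorem eLpNorm_lconvolution_le [SFinite μ] {p q r : ℝ≥0∞} (hp : 1 ≤ p) (hq : 1 ≤ q) (hr : 1 ≤ r)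
    (h : p⁻¹ + q⁻¹ = 1 + r⁻¹) {f g : G → ℝ≥0∞} (hf : Measurable f) (hg : Measurable g) :
    eLpNorm (f ⋆ₗ[μ] g) r μ ≤ eLpNorm f p μ * eLpNorm g q μ := by
  have hgx : ∀ x, Measurable fun y => g (-y + x) := fun x =>
    hg.comp (measurePreserving_neg_add (μ := μ) x).measurable
  -- For `r = ∞` the exponents `p` and `q` are conjugate; for `r < ∞` both are finite.
  rcases eq_or_ne r ∞ with rfl | hrt
  · refine eLpNorm_top_le (Filter.Eventually.of_forall fun x => ?_)
    rw [lconvolution_def]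
    refine (lintegral_mul_le_eLpNorm_mul_eLpNorm (by simpa using h) hf.aemeasurable
      (hgx x).aemeasurable).trans_eq ?_
    congr 1
    exact eLpNorm_comp_measurePreserving hg.aestronglyMeasurable (measurePreserving_neg_add x)
  have hp' : p⁻¹ ≤ 1 := ENNReal.inv_le_one.mpr hp
  have hq' : q⁻¹ ≤ 1 := ENNReal.inv_le_one.mpr hq
  have hr0 : r⁻¹ ≠ 0 := by simpa using hrt
  have hpt : p ≠ ∞ := by
    rintro rfl
    simp only [ENNReal.inv_top, zero_add] at h
    rw [h] at hq'
    exact absurd hq' (not_le.mpr (ENNReal.lt_add_right ENNReal.one_ne_top hr0))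
  have hqt : q ≠ ∞ := by
    rintro rfl
    simp only [ENNReal.inv_top, add_zero] at h
    rw [h] at hp'
    exact absurd hp' (not_le.mpr (ENNReal.lt_add_right ENNReal.one_ne_top hr0))
  have hp0 : p ≠ 0 := (zero_lt_one.trans_le hp).ne'
  have hq0 : q ≠ 0 := (zero_lt_one.trans_le hq).ne'
  have hr0 : r ≠ 0 := (zero_lt_one.trans_le hr).ne'
  have hR : p.toReal⁻¹ + q.toReal⁻¹ = 1 + r.toReal⁻¹ := by
    have := congrArg ENNReal.toReal h
    rwa [ENNReal.toReal_add (by simpa) (by simpa), ENNReal.toReal_add (by simp) (by simpa),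
      ENNReal.toReal_inv, ENNReal.toReal_inv, ENNReal.toReal_inv, ENNReal.toReal_one] at this
  have hP1 : p.toReal⁻¹ ≤ 1 := by
    rw [← ENNReal.toReal_inv]; simpa using ENNReal.toReal_mono ENNReal.one_ne_top hp'
  have hQ1 : q.toReal⁻¹ ≤ 1 := by
    rw [← ENNReal.toReal_inv]; simpa using ENNReal.toReal_mono ENNReal.one_ne_top hq'
  have hP0 := ENNReal.toReal_pos hp0 hpt
  have hQ0 := ENNReal.toReal_pos hq0 hqt
  have hR0 := ENNReal.toReal_pos hr0 hrt
  rw [← ENNReal.rpow_le_rpow_iff hR0, ENNReal.mul_rpow_of_nonneg _ _ hR0.le,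
    rpow_eLpNorm_toReal hr0 hrt]
  have hA := rpow_eLpNorm_toReal (μ := μ) hp0 hpt f
  have hB := rpow_eLpNorm_toReal (μ := μ) hq0 hqt g
  set P := p.toReal
  set Q := q.toReal
  set R := r.toReal
  set A := eLpNorm f p μ
  set B := eLpNorm g q μ
  have hBx : ∀ x, ∫⁻ y, g (-y + x) ^ Q ∂μ = B ^ Q := fun x => by
    rw [hB]
    exact (measurePreserving_neg_add x).lintegral_comp (hg.pow_const Q)
  have hw1 : 0 ≤ P⁻¹ - R⁻¹ := by linarith
  have hw2 : 0 ≤ Q⁻¹ - R⁻¹ := by linarith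
  -- Hölder's inequality for the three factors of
  -- `f(y) g(x - y) = (f(y)ᵖ g(x - y)^q)^{1/r} f(y)^{1 - p/r} g(x - y)^{1 - q/r}`
  have key : ∀ x, (f ⋆ₗ[μ] g) x ≤ (∫⁻ y, f y ^ P * g (-y + x) ^ Q ∂μ) ^ R⁻¹ *
      (A ^ P) ^ (P⁻¹ - R⁻¹) * (B ^ Q) ^ (Q⁻¹ - R⁻¹) := by
    intro x
    have h3 := ENNReal.lintegral_prod_norm_pow_le (μ := μ) (Finset.univ : Finset (Fin 3))
      (f := ![fun y => f y ^ P * g (-y + x) ^ Q, fun y => f y ^ P, fun y => g (-y + x) ^ Q])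
      (p := ![R⁻¹, P⁻¹ - R⁻¹, Q⁻¹ - R⁻¹])
      (by
        intro i _
        fin_cases i
        · exact ((hf.pow_const _).mul ((hgx x).pow_const _)).aemeasurable
        · exact (hf.pow_const _).aemeasurable
        · exact ((hgx x).pow_const _).aemeasurable)
      (by simp [Fin.sum_univ_three]; linarith)
      (by
        intro i _
        fin_cases i
        · exact inv_nonneg.mpr hR0.le
        · exact hw1
        · exact hw2)
    simp only [Fin.prod_univ_three, Matrix.cons_val_zero, Matrix.cons_val_one,
      Matrix.cons_val] at h3
    rw [← hA, hBx x] at h3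
    rw [lconvolution_def]
    refine le_trans (le_of_eq (lintegral_congr fun y => ?_)) h3
    have e1 : P * R⁻¹ + P * (P⁻¹ - R⁻¹) = 1 := by field_simp; ring
    have e2 : Q * R⁻¹ + Q * (Q⁻¹ - R⁻¹) = 1 := by field_simp; ring
    rw [ENNReal.mul_rpow_of_nonneg _ _ (inv_nonneg.mpr hR0.le), ← ENNReal.rpow_mul,
      ← ENNReal.rpow_mul, ← ENNReal.rpow_mul, ← ENNReal.rpow_mul]
    calc f y * g (-y + x)
        = f y ^ (P * R⁻¹ + P * (P⁻¹ - R⁻¹)) * g (-y + x) ^ (Q * R⁻¹ + Q * (Q⁻¹ - R⁻¹)) := by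
          rw [e1, e2, ENNReal.rpow_one, ENNReal.rpow_one]
      _ = _ := by
          rw [ENNReal.rpow_add_of_nonneg _ _ (by positivity) (mul_nonneg hP0.le hw1),
            ENNReal.rpow_add_of_nonneg _ _ (by positivity) (mul_nonneg hQ0.le hw2)]
          ring
  have hm : Measurable fun z : G × G => f z.2 ^ P * g (-z.2 + z.1) ^ Q :=
    ((hf.comp measurable_snd).pow_const _).mul
      ((hg.comp (measurable_snd.neg.add measurable_fst)).pow_const _)
  calc ∫⁻ x, (f ⋆ₗ[μ] g) x ^ R ∂μ
      ≤ ∫⁻ x, (∫⁻ y, f y ^ P * g (-y + x) ^ Q ∂μ) *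
          ((A ^ P) ^ (P⁻¹ - R⁻¹) * (B ^ Q) ^ (Q⁻¹ - R⁻¹)) ^ R ∂μ := by
        refine lintegral_mono fun x => (ENNReal.rpow_le_rpow (key x) hR0.le).trans_eq ?_
        rw [mul_assoc, ENNReal.mul_rpow_of_nonneg _ _ hR0.le, ← ENNReal.rpow_mul,
          inv_mul_cancel₀ hR0.ne', ENNReal.rpow_one]
    _ = (A ^ P * B ^ Q) * ((A ^ P) ^ (P⁻¹ - R⁻¹) * (B ^ Q) ^ (Q⁻¹ - R⁻¹)) ^ R := by
        rw [lintegral_mul_const _ hm.lintegral_prod_right']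
        congr 1
        rw [lintegral_lintegral_swap hm.aemeasurable, hA, ← lintegral_mul_const _ (hf.pow_const _)]
        refine lintegral_congr fun y => ?_
        have hgy : Measurable fun x => g (-y + x) := hg.comp (measurable_const_add _)
        dsimp only
        rw [lintegral_const_mul _ (hgy.pow_const _), hB,
          lintegral_add_left_eq_self (fun x => g x ^ Q) (-y)]
    _ = A ^ R * B ^ R := by
        rw [ENNReal.mul_rpow_of_nonneg _ _ hR0.le, ← ENNReal.rpow_mul, ← ENNReal.rpow_mul,
          ← ENNReal.rpow_mul, ← ENNReal.rpow_mul, mul_mul_mul_comm]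
        have w1 : 0 ≤ P * (P⁻¹ - R⁻¹) * R := mul_nonneg (mul_nonneg hP0.le hw1) hR0.le
        have w2 : 0 ≤ Q * (Q⁻¹ - R⁻¹) * R := mul_nonneg (mul_nonneg hQ0.le hw2) hR0.le
        rw [← mul_assoc P, ← mul_assoc Q] at *
        rw [← ENNReal.rpow_add_of_nonneg _ _ hP0.le w1, ← ENNReal.rpow_add_of_nonneg _ _ hQ0.le w2]
        congr 2 <;> field_simp <;> ring

end Young

/-! ### Mixed norms of `ℝ≥0∞`-valued functions -/

theorem ae_lt_top_of_eLpNorm_lt_top {α : Type*} [MeasurableSpace α] {μ : Measure α} {p : ℝ≥0∞}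
    (hp : 1 ≤ p) {f : α → ℝ≥0∞} (hf : Measurable f) (h : eLpNorm f p μ < ∞) :
    ∀ᵐ x ∂μ, f x < ∞ := by
  rcases eq_or_ne p ∞ with rfl | ht
  · filter_upwards [ae_le_eLpNorm_top (μ := μ) f] with x hx using hx.trans_lt h
  · have h0 : p ≠ 0 := (zero_lt_one.trans_le hp).ne'
    have hP := ENNReal.toReal_pos h0 ht
    have h1 : ∫⁻ x, f x ^ p.toReal ∂μ ≠ ∞ := by
      rw [← rpow_eLpNorm_toReal h0 ht]
      exact ENNReal.rpow_ne_top_of_nonneg hP.le h.ne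
    filter_upwards [ae_lt_top (hf.pow_const _) h1] with x hx
    exact (ENNReal.rpow_lt_top_iff_of_pos hP).mp hx

/-- The mixed norm of an `ℝ≥0∞`-valued function on a product: the `p`-norm in the first variable,
then the `q`-norm in the second one. -/
def mixedENorm {X Y : Type*} [MeasureSpace X] [MeasureSpace Y] (p q : ℝ≥0∞)
    (F : X × Y → ℝ≥0∞) : ℝ≥0∞ :=
  eLpNorm (fun ω => eLpNorm (fun x => F (x, ω)) p volume) q volume

section Mixed

variable {X Y : Type*} [MeasureSpace X] [MeasureSpace Y]

theorem mixedENorm_mono_ae [SFinite (volume : Measure X)] [SFinite (volume : Measure Y)]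
    (p q : ℝ≥0∞) {F G : X × Y → ℝ≥0∞} (h : ∀ᵐ z, F z ≤ G z) :
    mixedENorm p q F ≤ mixedENorm p q G := by
  have h1 : ∀ᵐ z ∂((volume : Measure Y).prod (volume : Measure X)), F z.swap ≤ G z.swap :=
    (Measure.measurePreserving_swap (μ := (volume : Measure Y))
      (ν := (volume : Measure X))).quasiMeasurePreserving.ae (by rwa [← Measure.volume_eq_prod])
  refine eLpNorm_mono_fun_ae q ?_
  filter_upwards [Measure.ae_ae_of_ae_prod h1] with ω hω
  exact eLpNorm_mono_fun_ae p hω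

theorem mixedENorm_mono (p q : ℝ≥0∞) {F G : X × Y → ℝ≥0∞} (h : ∀ z, F z ≤ G z) :
    mixedENorm p q F ≤ mixedENorm p q G :=
  eLpNorm_mono_fun q fun _ => eLpNorm_mono_fun p fun _ => h _

theorem mixedENorm_congr_ae [SFinite (volume : Measure X)] [SFinite (volume : Measure Y)]
    (p q : ℝ≥0∞) {F G : X × Y → ℝ≥0∞} (h : ∀ᵐ z, F z = G z) :
    mixedENorm p q F = mixedENorm p q G :=
  le_antisymm (mixedENorm_mono_ae p q (h.mono fun _ hz => hz.le))
    (mixedENorm_mono_ae p q (h.mono fun _ hz => hz.ge))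

theorem mixedENorm_const_mul [SFinite (volume : Measure X)] {p q : ℝ≥0∞} (hp : 1 ≤ p)
    (hq : 1 ≤ q) {F : X × Y → ℝ≥0∞} (hF : Measurable F) (c : ℝ≥0∞) :
    mixedENorm p q (fun z => c * F z) ≤ c * mixedENorm p q F :=
  (eLpNorm_mono_fun q fun ω =>
    eLpNorm_const_mul hp (hF.comp (measurable_prodMk_right (y := ω))) c).trans
    (eLpNorm_const_mul hq (measurable_eLpNorm_section p hF) c)

theorem mixedENorm_one_one [SFinite (volume : Measure X)] [SFinite (volume : Measure Y)]
    {F : X × Y → ℝ≥0∞} (hF : Measurable F) : mixedENorm 1 1 F = ∫⁻ z, F z := by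
  simp_rw [mixedENorm, eLpNorm_one_eq_lintegral]
  rw [Measure.volume_eq_prod, lintegral_prod_symm' _ hF]

/-- A tensor product has mixed norm at most the product of the norms of its factors. -/
theorem mixedENorm_mul_le {p q : ℝ≥0∞} (hp : 1 ≤ p) (hq : 1 ≤ q) {u : X → ℝ≥0∞} {v : Y → ℝ≥0∞}
    (hu : Measurable u) (hv : Measurable v) :
    mixedENorm p q (fun z => u z.1 * v z.2) ≤ eLpNorm u p volume * eLpNorm v q volume := by
  refine (eLpNorm_mono_fun q (g := fun ω => eLpNorm u p volume * v ω) fun ω => ?_).trans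
    (eLpNorm_const_mul hq hv _)
  simp_rw [mul_comm (u _), mul_comm (eLpNorm u p volume)]
  exact eLpNorm_const_mul hp hu (v ω)

theorem ae_lt_top_of_mixedENorm_lt_top [SFinite (volume : Measure X)]
    [SFinite (volume : Measure Y)] {p q : ℝ≥0∞} (hp : 1 ≤ p) (hq : 1 ≤ q)
    {F : X × Y → ℝ≥0∞} (hF : Measurable F) (h : mixedENorm p q F < ∞) : ∀ᵐ z, F z < ∞ := by
  have h1 := ae_lt_top_of_eLpNorm_lt_top hq (measurable_eLpNorm_section p hF) h
  have h2 : ∀ᵐ ω : Y, ∀ᵐ x : X, F (x, ω) < ∞ := by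
    filter_upwards [h1] with ω hω
    exact ae_lt_top_of_eLpNorm_lt_top hp (hF.comp measurable_prodMk_right) hω
  have hs : MeasurableSet {z | F z < ∞} := measurableSet_lt hF measurable_const
  rw [Measure.volume_eq_prod, Measure.ae_prod_iff_ae_ae hs]
  exact (Measure.ae_ae_comm (p := fun x ω => F (x, ω) < ∞) hs).mpr h2

/-- Hölder's inequality for mixed norms. -/
theorem lintegral_mul_le_mixedENorm_mul_mixedENorm [SFinite (volume : Measure X)]
    [SFinite (volume : Measure Y)] {p q p' q' : ℝ≥0∞} (hp : p⁻¹ + p'⁻¹ = 1)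
    (hq : q⁻¹ + q'⁻¹ = 1) {F G : X × Y → ℝ≥0∞} (hF : Measurable F) (hG : Measurable G) :
    ∫⁻ z, F z * G z ≤ mixedENorm p q F * mixedENorm p' q' G := by
  have hm : Measurable fun z => F z * G z := hF.mul hG
  rw [Measure.volume_eq_prod, lintegral_prod_symm' _ hm]
  refine (lintegral_mono fun ω => lintegral_mul_le_eLpNorm_mul_eLpNorm hp
    (hF.comp measurable_prodMk_right).aemeasurable
    (hG.comp measurable_prodMk_right).aemeasurable).trans ?_
  exact lintegral_mul_le_eLpNorm_mul_eLpNorm hq (measurable_eLpNorm_section p hF).aemeasurable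
    (measurable_eLpNorm_section p' hG).aemeasurable

variable [AddCommGroup X] [AddCommGroup Y]

theorem mixedENorm_neg [SFinite (volume : Measure X)] [MeasurableNeg X] [MeasurableNeg Y]
    [(volume : Measure X).IsNegInvariant] [(volume : Measure Y).IsNegInvariant] (p q : ℝ≥0∞)
    {F : X × Y → ℝ≥0∞} (hF : Measurable F) :
    mixedENorm p q (fun z => F (-z)) = mixedENorm p q F := by
  have h1 : ∀ ω : Y, eLpNorm (fun x : X => F (-(x, ω))) p volume =
      eLpNorm (fun x => F (x, -ω)) p volume := fun ω =>
    eLpNorm_comp_measurePreserving (g := fun x => F (x, -ω))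
      (hF.comp measurable_prodMk_right).aestronglyMeasurable
      (Measure.measurePreserving_neg (volume : Measure X))
  simp_rw [mixedENorm, h1]
  exact eLpNorm_comp_measurePreserving (g := fun ω => eLpNorm (fun x => F (x, ω)) p volume)
    (measurable_eLpNorm_section p hF).aestronglyMeasurable
    (Measure.measurePreserving_neg (volume : Measure Y))

theorem mixedENorm_sub_right [SFinite (volume : Measure X)] [MeasurableAdd₂ X] [MeasurableAdd₂ Y]
    [MeasurableNeg X] [MeasurableNeg Y]
    [(volume : Measure X).IsAddRightInvariant] [(volume : Measure Y).IsAddRightInvariant]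
    (p q : ℝ≥0∞) {F : X × Y → ℝ≥0∞} (hF : Measurable F) (z : X × Y) :
    mixedENorm p q (fun w => F (w - z)) = mixedENorm p q F := by
  have h1 : ∀ ω : Y, eLpNorm (fun x : X => F ((x, ω) - z)) p volume =
      eLpNorm (fun x => F (x, ω - z.2)) p volume := fun ω =>
    eLpNorm_comp_measurePreserving
      (g := fun x => F (x, ω - z.2)) (hF.comp measurable_prodMk_right).aestronglyMeasurable
      (measurePreserving_sub_right (volume : Measure X) z.1)
  simp_rw [mixedENorm, h1]
  exact eLpNorm_comp_measurePreserving
    (g := fun ω => eLpNorm (fun x => F (x, ω)) p volume)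
    (measurable_eLpNorm_section p hF).aestronglyMeasurable
    (measurePreserving_sub_right (volume : Measure Y) z.2)

/-- Young's inequality for mixed norms: Minkowski's inequality reduces it to Young's inequality in
each of the two variables. -/
theorem mixedENorm_lconvolution_le [SFinite (volume : Measure X)] [SFinite (volume : Measure Y)]
    [MeasurableAdd₂ X] [MeasurableAdd₂ Y] [MeasurableNeg X] [MeasurableNeg Y]
    [(volume : Measure X).IsAddLeftInvariant] [(volume : Measure Y).IsAddLeftInvariant]
    [(volume : Measure X).IsNegInvariant] [(volume : Measure Y).IsNegInvariant]
    {p₁ p₂ q₁ q₂ r₁ r₂ : ℝ≥0∞} (hp₁ : 1 ≤ p₁) (hp₂ : 1 ≤ p₂) (hq₁ : 1 ≤ q₁) (hq₂ : 1 ≤ q₂)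
    (hr₁ : 1 ≤ r₁) (hr₂ : 1 ≤ r₂) (h₁ : p₁⁻¹ + q₁⁻¹ = 1 + r₁⁻¹) (h₂ : p₂⁻¹ + q₂⁻¹ = 1 + r₂⁻¹)
    {F G : X × Y → ℝ≥0∞} (hF : Measurable F) (hG : Measurable G) :
    mixedENorm r₁ r₂ (F ⋆ₗ[volume] G) ≤ mixedENorm p₁ p₂ F * mixedENorm q₁ q₂ G := by
  have hFs : ∀ ω, Measurable fun x => F (x, ω) := fun ω => hF.comp measurable_prodMk_right
  have hGs : ∀ ω, Measurable fun x => G (x, ω) := fun ω => hG.comp measurable_prodMk_right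
  refine le_trans (eLpNorm_mono_fun r₂ fun ω => ?_) (eLpNorm_lconvolution_le hp₂ hq₂ hr₂ h₂
    (f := fun ω => eLpNorm (fun x => F (x, ω)) p₁ volume)
    (g := fun ω => eLpNorm (fun x => G (x, ω)) q₁ volume)
    (measurable_eLpNorm_section p₁ hF) (measurable_eLpNorm_section q₁ hG))
  set H : X × Y → ℝ≥0∞ := fun z =>
    ((fun x => F (x, z.2)) ⋆ₗ[volume] fun x => G (x, -z.2 + ω)) z.1 with hHdef
  have hH : Measurable H := by
    simp only [hHdef, lconvolution_def]
    refine Measurable.lintegral_prod_right' (f := fun u : (X × Y) × X =>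
      F (u.2, u.1.2) * G (-u.2 + u.1.1, -u.1.2 + ω)) ?_
    refine (hF.comp (by fun_prop)).mul (hG.comp (by fun_prop))
  have e : ∀ x, (F ⋆ₗ[volume] G) (x, ω) = ∫⁻ ω', H (x, ω') := by
    intro x
    have hm : Measurable fun y : X × Y => F y * G (-y + (x, ω)) :=
      hF.mul (hG.comp ((measurable_fst.neg.add_const x).prodMk (measurable_snd.neg.add_const ω)))
    rw [lconvolution_def, Measure.volume_eq_prod, lintegral_prod_symm' _ hm]
    rfl
  simp_rw [e]
  refine (eLpNorm_lintegral_le hr₁ hH).trans ?_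
  rw [lconvolution_def]
  exact lintegral_mono fun ω' => eLpNorm_lconvolution_le (f := fun x => F (x, ω'))
    (g := fun x => G (x, -ω' + ω)) hp₁ hq₁ hr₁ h₁ (hFs ω') (hGs _)

end Mixed

/-! ### A weight on phase space -/

/-- An integrable polynomially decaying weight on `ℝᵈ`. -/
def weight {d : ℕ} (x : RR d) : ℝ≥0∞ := ENNReal.ofReal (((1 + ‖x‖) ^ (d + 1))⁻¹)

/-- The tensor product of two copies of the weight, on phase space. -/
def phaseWeight {d : ℕ} (z : RR d × RR d) : ℝ≥0∞ := weight z.1 * weight z.2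

variable {d : ℕ}

theorem measurable_weight : Measurable (weight (d := d)) := by
  unfold weight; fun_prop

theorem measurable_phaseWeight : Measurable (phaseWeight (d := d)) :=
  (measurable_weight.comp measurable_fst).mul (measurable_weight.comp measurable_snd)

theorem weight_le_one (x : RR d) : weight x ≤ 1 := by
  unfold weight
  rw [ENNReal.ofReal_le_one]
  exact inv_le_one_of_one_le₀ (one_le_pow₀ (by linarith [norm_nonneg x]))

theorem eLpNorm_weight_lt_top {p : ℝ≥0∞} (hp : 1 ≤ p) :
    eLpNorm (weight (d := d)) p volume < ∞ := by
  rcases eq_or_ne p ∞ with rfl | ht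
  · exact (eLpNorm_top_le (Filter.Eventually.of_forall weight_le_one)).trans_lt ENNReal.one_lt_top
  have h0 : p ≠ 0 := (zero_lt_one.trans_le hp).ne'
  have hP : 1 ≤ p.toReal := by simpa using ENNReal.toReal_mono ht hp
  have h1 : ∫⁻ x : RR d, weight x < ∞ := by
    have hi := integrable_one_add_norm (E := RR d) (μ := volume) (r := d + 1) (by simp)
    refine lt_of_eq_of_lt (lintegral_congr fun x => ?_) hi.lintegral_lt_top
    have : (0 : ℝ) ≤ 1 + ‖x‖ := by positivity
    unfold weight
    congr 1
    rw [Real.rpow_neg this]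
    norm_cast
  rw [eLpNorm_eq_lintegral_rpow_enorm_toReal h0 ht]
  refine ENNReal.rpow_lt_top_of_nonneg (by positivity) (ne_top_of_le_ne_top h1.ne ?_)
  refine lintegral_mono fun x => ?_
  simpa using ENNReal.rpow_le_rpow_of_exponent_ge (weight_le_one x) hP

theorem mixedENorm_phaseWeight_lt_top {p q : ℝ≥0∞} (hp : 1 ≤ p) (hq : 1 ≤ q) :
    mixedENorm p q (phaseWeight (d := d)) < ∞ :=
  (mixedENorm_mul_le hp hq measurable_weight measurable_weight).trans_lt
    (ENNReal.mul_lt_top (eLpNorm_weight_lt_top hp) (eLpNorm_weight_lt_top hq))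

/-! ### Tempered distributions and integrals of Schwartz functions -/

section WeakIntegral

variable {V : Type*} [NormedAddCommGroup V] [NormedSpace ℝ V]

/-- The space of `l`-linear maps in which the `l`-th derivative of a Schwartz function takes its
values. It is a copy of `V [×l]→L[ℝ] ℂ` with its standard structure, kept opaque for instance
search. -/
def DerivSpace (V : Type*) [NormedAddCommGroup V] [NormedSpace ℝ V] (l : ℕ) : Type _ :=
  V [×l]→L[ℝ] ℂ

instance (l : ℕ) : NormedAddCommGroup (DerivSpace V l) :=
  inferInstanceAs (NormedAddCommGroup (V [×l]→L[ℝ] ℂ))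

instance (l : ℕ) : NormedSpace ℂ (DerivSpace V l) :=
  inferInstanceAs (NormedSpace ℂ (V [×l]→L[ℝ] ℂ))

instance (l : ℕ) : NormedSpace ℝ (DerivSpace V l) :=
  inferInstanceAs (NormedSpace ℝ (V [×l]→L[ℝ] ℂ))

instance (l : ℕ) : CompleteSpace (DerivSpace V l) :=
  inferInstanceAs (CompleteSpace (V [×l]→L[ℝ] ℂ))

/-- The `l`-th derivative of a Schwartz function at a point. -/
def schwartzDeriv (l : ℕ) (f : 𝓢(V, ℂ)) (x : V) : DerivSpace V l := iteratedFDeriv ℝ l f x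

theorem norm_schwartzDeriv (l : ℕ) (f : 𝓢(V, ℂ)) (x : V) :
    ‖schwartzDeriv l f x‖ = ‖iteratedFDeriv ℝ l f x‖ := rfl

theorem continuous_schwartzDeriv (l : ℕ) (f : 𝓢(V, ℂ)) : Continuous (schwartzDeriv l f) :=
  (f.smooth l).continuous_iteratedFDeriv le_rfl

theorem schwartzDeriv_add (l : ℕ) (f g : 𝓢(V, ℂ)) (x : V) :
    schwartzDeriv l (f + g) x = schwartzDeriv l f x + schwartzDeriv l g x :=
  iteratedFDeriv_add_apply (f.smooth l).contDiffAt (g.smooth l).contDiffAt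

theorem schwartzDeriv_smul (l : ℕ) (a : ℂ) (f : 𝓢(V, ℂ)) (x : V) :
    schwartzDeriv l (a • f) x = a • schwartzDeriv l f x :=
  iteratedFDeriv_const_smul_apply (f.smooth l).contDiffAt

/-- The continuous linear map `f ↦ ‖x‖ᵏ Dˡf(x)` from Schwartz functions to bounded continuous
functions. -/
def weightedDeriv (k l : ℕ) : 𝓢(V, ℂ) →L[ℂ] BoundedContinuousFunction V (DerivSpace V l) :=
  SchwartzMap.mkCLMtoNormedSpace (D := V) (E := ℂ) (σ := RingHom.id ℂ)
    (fun f => BoundedContinuousFunction.ofNormedAddCommGroup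
      (fun x => ((‖x‖ ^ k : ℝ) : ℂ) • schwartzDeriv l f x)
      ((Complex.continuous_ofReal.comp (continuous_norm.pow k)).smul (continuous_schwartzDeriv l f))
      (SchwartzMap.seminorm ℂ k l f)
      (fun x => by
        rw [norm_smul, norm_schwartzDeriv]
        simpa using SchwartzMap.le_seminorm ℂ k l f x))
    (fun f g => by
      ext1 x
      simp only [BoundedContinuousFunction.coe_ofNormedAddCommGroup, schwartzDeriv_add, smul_add,
        BoundedContinuousFunction.coe_add, Pi.add_apply])
    (fun a f => by
      ext1 x
      simp only [BoundedContinuousFunction.coe_ofNormedAddCommGroup, schwartzDeriv_smul,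
        BoundedContinuousFunction.coe_smul, RingHom.id_apply]
      rw [smul_comm])
    ⟨{(k, l)}, 1, zero_le_one, fun f => by
      rw [one_mul, Finset.sup_singleton]
      exact BoundedContinuousFunction.norm_ofNormedAddCommGroup_le _
        (apply_nonneg (SchwartzMap.seminorm ℂ k l) f) _⟩

theorem weightedDeriv_apply (k l : ℕ) (f : 𝓢(V, ℂ)) (x : V) :
    weightedDeriv k l f x = ((‖x‖ ^ k : ℝ) : ℂ) • schwartzDeriv l f x := rfl

theorem seminorm_le_norm_weightedDeriv (k l : ℕ) (f : 𝓢(V, ℂ)) :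
    SchwartzMap.seminorm ℂ k l f ≤ ‖weightedDeriv k l f‖ := by
  refine SchwartzMap.seminorm_le_bound ℂ k l f (norm_nonneg _) fun x => ?_
  have := (weightedDeriv k l f).norm_coe_le_norm x
  simpa [weightedDeriv_apply, norm_smul, norm_schwartzDeriv] using this

theorem norm_weightedDeriv_le (k l : ℕ) (f : 𝓢(V, ℂ)) :
    ‖weightedDeriv k l f‖ ≤ SchwartzMap.seminorm ℂ k l f :=
  (BoundedContinuousFunction.norm_le (apply_nonneg (SchwartzMap.seminorm ℂ k l) f)).mpr fun x => by
    rw [weightedDeriv_apply, norm_smul, norm_schwartzDeriv]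
    simpa using SchwartzMap.le_seminorm ℂ k l f x

/-- A tempered distribution factors through finitely many of the maps `weightedDeriv`, by the
Hahn–Banach theorem. -/
theorem exists_factor_weightedDeriv (ψ : 𝓢(V, ℂ) →L[ℂ] ℂ) :
    ∃ (s : Finset (ℕ × ℕ))
      (Λ : (∀ i : s, BoundedContinuousFunction V (DerivSpace V i.1.2)) →L[ℂ] ℂ),
      ∀ f, ψ f = Λ (fun i => weightedDeriv i.1.1 i.1.2 f) := by
  obtain ⟨s, C, -, hC⟩ := Seminorm.bound_of_continuous (schwartz_withSeminorms ℂ V ℂ)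
    ((normSeminorm ℂ ℂ).comp ψ.toLinearMap) (continuous_norm.comp ψ.continuous)
  let J : 𝓢(V, ℂ) →L[ℂ] (∀ i : s, BoundedContinuousFunction V (DerivSpace V i.1.2)) :=
    ContinuousLinearMap.pi fun i => weightedDeriv i.1.1 i.1.2
  have hJ : ∀ f, ‖ψ f‖ ≤ C * ‖J f‖ := by
    intro f
    refine (hC f).trans ?_
    change (C : ℝ) * (s.sup (schwartzSeminormFamily ℂ V ℂ)) f ≤ _
    refine mul_le_mul_of_nonneg_left ?_ C.2
    refine Seminorm.finset_sup_apply_le (norm_nonneg _) fun i hi => ?_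
    exact (seminorm_le_norm_weightedDeriv i.1 i.2 f).trans (norm_le_pi_norm (J f) ⟨i, hi⟩)
  let J' := J.toLinearMap.rangeRestrict
  obtain ⟨σ, hσ⟩ := J'.exists_rightInverse_of_surjective J.toLinearMap.range_rangeRestrict
  have hσ' : ∀ y, J (σ y) = y := fun y => by
    have := congrArg Subtype.val (LinearMap.congr_fun hσ y)
    exact this
  let Λ₀ : J.toLinearMap.range →L[ℂ] ℂ := (ψ.toLinearMap ∘ₗ σ).mkContinuous C fun y => by
    refine (hJ (σ y)).trans_eq ?_
    rw [hσ']
    rfl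
  obtain ⟨Λ, hΛ, -⟩ := exists_extension_norm_eq _ Λ₀
  refine ⟨s, Λ, fun f => ?_⟩
  have h1 : Λ (J f) = ψ (σ (J' f)) := hΛ (J' f)
  have h2 : ‖ψ (f - σ (J' f))‖ ≤ C * ‖J (f - σ (J' f))‖ := hJ _
  have h3 : J (f - σ (J' f)) = 0 := by
    rw [map_sub, hσ', sub_eq_zero]
    rfl
  rw [h3, norm_zero, mul_zero, norm_le_zero_iff, map_sub, sub_eq_zero] at h2
  rw [h2, ← h1]
  rfl

variable {W : Type*} [TopologicalSpace W] [MeasurableSpace W] [OpensMeasurableSpace W]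
  [SecondCountableTopology W] {ν : Measure W}

theorem integrable_weightedDeriv {Ψ : W → 𝓢(V, ℂ)} (hc : Continuous Ψ)
    (hi : ∀ k l, Integrable (fun w => SchwartzMap.seminorm ℂ k l (Ψ w)) ν) (k l : ℕ) :
    Integrable (fun w => weightedDeriv k l (Ψ w)) ν :=
  (hi k l).mono' ((weightedDeriv k l).continuous.comp hc).aestronglyMeasurable
    (Filter.Eventually.of_forall fun w => norm_weightedDeriv_le k l (Ψ w))

theorem integrable_schwartzDeriv {Ψ : W → 𝓢(V, ℂ)} (hc : Continuous Ψ)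
    (hi : ∀ k l, Integrable (fun w => SchwartzMap.seminorm ℂ k l (Ψ w)) ν) (l : ℕ) (x : V) :
    Integrable (fun w => schwartzDeriv l (Ψ w) x) ν := by
  have := (BoundedContinuousFunction.evalCLM ℂ x).integrable_comp
    (integrable_weightedDeriv hc hi 0 l)
  refine this.congr (Filter.Eventually.of_forall fun w => ?_)
  simp [weightedDeriv_apply]

/-- Currying, as an equivalence between the space of derivatives of order `l + 1` and the space of
linear maps into derivatives of order `l`. -/
def curryDeriv (V : Type*) [NormedAddCommGroup V] [NormedSpace ℝ V] (l : ℕ) :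
    DerivSpace V (l + 1) ≃ₗᵢ[ℝ] (V →L[ℝ] DerivSpace V l) :=
  continuousMultilinearCurryLeftEquiv ℝ (fun _ : Fin (l + 1) => V) ℂ

theorem hasFDerivAt_schwartzDeriv (l : ℕ) (f : 𝓢(V, ℂ)) (x : V) :
    HasFDerivAt (schwartzDeriv l f) (curryDeriv V l (schwartzDeriv (l + 1) f x)) x := by
  have h1 : curryDeriv V l (schwartzDeriv (l + 1) f x) = fderiv ℝ (iteratedFDeriv ℝ l f) x := by
    rw [schwartzDeriv, iteratedFDeriv_succ_eq_comp_left]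
    exact (continuousMultilinearCurryLeftEquiv ℝ (fun _ : Fin (l + 1) => V) ℂ).apply_symm_apply _
  rw [h1]
  exact ((f.smooth ⊤).differentiable_iteratedFDeriv
    (by exact_mod_cast WithTop.coe_lt_top l)).differentiableAt.hasFDerivAt

/-- Differentiation under the integral sign: if a family of Schwartz functions has integrable
seminorms and integrates pointwise to a Schwartz function, then so do its derivatives. -/
theorem integral_schwartzDeriv {Ψ : W → 𝓢(V, ℂ)} (hc : Continuous Ψ)
    (hi : ∀ k l, Integrable (fun w => SchwartzMap.seminorm ℂ k l (Ψ w)) ν) {F : 𝓢(V, ℂ)}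
    (hF : ∀ t, ∫ w, Ψ w t ∂ν = F t) (l : ℕ) (x : V) :
    ∫ w, schwartzDeriv l (Ψ w) x ∂ν = schwartzDeriv l F x := by
  induction l generalizing x with
  | zero =>
    have h0 : ∀ f : 𝓢(V, ℂ), schwartzDeriv 0 f x =
        (continuousMultilinearCurryFin0 ℝ V ℂ).symm (f x) := fun f => by
      rw [schwartzDeriv, iteratedFDeriv_zero_eq_comp]; rfl
    simp only [h0]
    rw [← hF x]
    exact (continuousMultilinearCurryFin0 ℝ V ℂ).symm.toContinuousLinearEquiv.integral_comp_comm
      fun w => Ψ w x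
  | succ l ih =>
    have key : HasFDerivAt (fun y => ∫ w, schwartzDeriv l (Ψ w) y ∂ν)
        (∫ w, curryDeriv V l (schwartzDeriv (l + 1) (Ψ w) x) ∂ν) x := by
      refine hasFDerivAt_integral_of_dominated_of_fderiv_le
        (bound := fun w => SchwartzMap.seminorm ℂ 0 (l + 1) (Ψ w))
        (F' := fun y w => curryDeriv V l (schwartzDeriv (l + 1) (Ψ w) y)) Filter.univ_mem
        (Filter.Eventually.of_forall fun y => (integrable_schwartzDeriv hc hi l y).1)
        (integrable_schwartzDeriv hc hi l x) ?_ ?_ (hi 0 (l + 1)) ?_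
      · exact (curryDeriv V l).continuous.comp_aestronglyMeasurable
          (integrable_schwartzDeriv hc hi (l + 1) x).1
      · refine Filter.Eventually.of_forall fun w y _ => ?_
        rw [LinearIsometryEquiv.norm_map]
        exact SchwartzMap.norm_iteratedFDeriv_le_seminorm ℂ (Ψ w) (l + 1) y
      · exact Filter.Eventually.of_forall fun w y _ => hasFDerivAt_schwartzDeriv l (Ψ w) y
    have h1 : (fun y => ∫ w, schwartzDeriv l (Ψ w) y ∂ν) = schwartzDeriv l F := funext ih
    rw [h1] at key
    apply (curryDeriv V l).injective
    rw [← key.unique (hasFDerivAt_schwartzDeriv l F x)]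
    exact ((curryDeriv V l).toContinuousLinearEquiv.integral_comp_comm
        fun w => schwartzDeriv (l + 1) (Ψ w) x).symm

/-- A tempered distribution commutes with the integral of a continuous family of Schwartz functions
with integrable seminorms, the integral being taken pointwise. -/
theorem integral_apply_schwartz {Ψ : W → 𝓢(V, ℂ)} (hc : Continuous Ψ)
    (hi : ∀ k l, Integrable (fun w => SchwartzMap.seminorm ℂ k l (Ψ w)) ν) {F : 𝓢(V, ℂ)}
    (hF : ∀ t, ∫ w, Ψ w t ∂ν = F t) (ψ : 𝓢(V, ℂ) →L[ℂ] ℂ) :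
    Integrable (fun w => ψ (Ψ w)) ν ∧ ∫ w, ψ (Ψ w) ∂ν = ψ F := by
  obtain ⟨s, Λ, hΛ⟩ := exists_factor_weightedDeriv ψ
  have hint : Integrable (fun w => fun i : s => weightedDeriv i.1.1 i.1.2 (Ψ w)) ν :=
    Integrable.of_eval fun i => integrable_weightedDeriv hc hi i.1.1 i.1.2
  have hval : ∫ w, (fun i : s => weightedDeriv i.1.1 i.1.2 (Ψ w)) ∂ν =
      fun i : s => weightedDeriv i.1.1 i.1.2 F := by
    ext1 i
    rw [eval_integral fun j => integrable_weightedDeriv hc hi j.1.1 j.1.2]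
    ext1 x
    have h2 := (BoundedContinuousFunction.evalCLM ℂ x).integral_comp_comm
      (integrable_weightedDeriv hc hi i.1.1 i.1.2)
    rw [BoundedContinuousFunction.evalCLM_apply] at h2
    rw [← h2]
    simp only [BoundedContinuousFunction.evalCLM_apply, weightedDeriv_apply]
    rw [integral_smul, integral_schwartzDeriv hc hi hF]
  simp_rw [hΛ]
  exact ⟨Λ.integrable_comp hint, by rw [Λ.integral_comp_comm hint, hval]⟩

end WeakIntegral

/-! ### Time-frequency shifts on the Schwartz space -/

/-- The sum of finitely many Schwartz seminorms. -/
def sumSeminorm {V : Type*} [NormedAddCommGroup V] [NormedSpace ℝ V] (s : Finset (ℕ × ℕ))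
    (f : 𝓢(V, ℂ)) : ℝ := ∑ i ∈ s, SchwartzMap.seminorm ℂ i.1 i.2 f

section Seminorms

variable {V : Type*} [NormedAddCommGroup V] [NormedSpace ℝ V]

theorem sumSeminorm_nonneg (s : Finset (ℕ × ℕ)) (f : 𝓢(V, ℂ)) : 0 ≤ sumSeminorm s f :=
  Finset.sum_nonneg fun _ _ => apply_nonneg _ _

theorem sup_seminorm_le_sumSeminorm (s : Finset (ℕ × ℕ)) (f : 𝓢(V, ℂ)) :
    s.sup (fun m => SchwartzMap.seminorm ℂ m.1 m.2) f ≤ sumSeminorm s f := by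
  refine (Seminorm.finset_sup_le_sum _ s f).trans_eq ?_
  rw [sumSeminorm]
  induction s using Finset.cons_induction with
  | empty => simp
  | cons a s ha ih => rw [Finset.sum_cons, Finset.sum_cons, ← ih]; rfl

theorem one_add_norm_pow_mul_le (k l : ℕ) (f : 𝓢(V, ℂ)) (x : V) :
    (1 + ‖x‖) ^ k * ‖iteratedFDeriv ℝ l f x‖ ≤ 2 ^ k * sumSeminorm (Finset.Iic (k, l)) f :=
  (SchwartzMap.one_add_le_sup_seminorm_apply (𝕜 := ℂ) (m := (k, l)) le_rfl le_rfl f x).trans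
    (mul_le_mul_of_nonneg_left (sup_seminorm_le_sumSeminorm _ f) (by positivity))

theorem one_add_norm_pow_mul_norm_le (k : ℕ) (f : 𝓢(V, ℂ)) (x : V) :
    (1 + ‖x‖) ^ k * ‖f x‖ ≤ 2 ^ k * sumSeminorm (Finset.Iic (k, 0)) f := by
  simpa using one_add_norm_pow_mul_le k 0 f x

theorem exists_seminorm_le_sumSeminorm {V' : Type*} [NormedAddCommGroup V'] [NormedSpace ℝ V']
    (A : 𝓢(V, ℂ) →L[ℂ] 𝓢(V', ℂ)) (k l : ℕ) :
    ∃ (s : Finset (ℕ × ℕ)) (C : ℝ), 0 ≤ C ∧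
      ∀ f, SchwartzMap.seminorm ℂ k l (A f) ≤ C * sumSeminorm s f := by
  obtain ⟨s, C, -, hC⟩ := Seminorm.bound_of_continuous (schwartz_withSeminorms ℂ V ℂ)
    ((schwartzSeminormFamily ℂ V' ℂ (k, l)).comp A.toLinearMap)
    (((schwartz_withSeminorms ℂ V' ℂ).continuous_seminorm (k, l)).comp A.continuous)
  refine ⟨s, C, C.2, fun f => (hC f).trans ?_⟩
  exact mul_le_mul_of_nonneg_left (sup_seminorm_le_sumSeminorm s f) C.2

theorem exists_sumSeminorm_le_sumSeminorm {V' : Type*} [NormedAddCommGroup V'] [NormedSpace ℝ V']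
    (A : 𝓢(V, ℂ) →L[ℂ] 𝓢(V', ℂ)) (t : Finset (ℕ × ℕ)) :
    ∃ (s : Finset (ℕ × ℕ)) (C : ℝ), 0 ≤ C ∧ ∀ f, sumSeminorm t (A f) ≤ C * sumSeminorm s f := by
  classical
  choose s C hC h using fun i : ℕ × ℕ => exists_seminorm_le_sumSeminorm A i.1 i.2
  refine ⟨t.biUnion s, ∑ i ∈ t, C i, Finset.sum_nonneg fun i _ => hC i, fun f => ?_⟩
  rw [Finset.sum_mul]
  refine Finset.sum_le_sum fun i hi => (h i f).trans (mul_le_mul_of_nonneg_left ?_ (hC i))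
  exact Finset.sum_le_sum_of_subset_of_nonneg (Finset.subset_biUnion_of_mem s hi)
    fun _ _ _ => apply_nonneg _ _

end Seminorms

/-- A family of operators on the Schwartz space whose seminorm bounds grow at most polynomially in
the parameter. -/
def PolyBounded {X V : Type*} [SeminormedAddCommGroup X] [NormedAddCommGroup V] [NormedSpace ℝ V]
    (A : X → 𝓢(V, ℂ) → 𝓢(V, ℂ)) : Prop :=
  ∀ k l, ∃ (s : Finset (ℕ × ℕ)) (C : ℝ) (N : ℕ), 0 ≤ C ∧
    ∀ x f, SchwartzMap.seminorm ℂ k l (A x f) ≤ C * (1 + ‖x‖) ^ N * sumSeminorm s f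

section PolyBounded

variable {X Y V : Type*} [SeminormedAddCommGroup X] [SeminormedAddCommGroup Y]
  [NormedAddCommGroup V] [NormedSpace ℝ V] {A B : X → 𝓢(V, ℂ) → 𝓢(V, ℂ)}

theorem PolyBounded.sumSeminorm_le (hA : PolyBounded A) (t : Finset (ℕ × ℕ)) :
    ∃ (s : Finset (ℕ × ℕ)) (C : ℝ) (N : ℕ), 0 ≤ C ∧
      ∀ x f, sumSeminorm t (A x f) ≤ C * (1 + ‖x‖) ^ N * sumSeminorm s f := by
  classical
  choose s C N hC h using fun i : ℕ × ℕ => hA i.1 i.2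
  refine ⟨t.biUnion s, ∑ i ∈ t, C i, t.sup N, Finset.sum_nonneg fun i _ => hC i, fun x f => ?_⟩
  rw [Finset.sum_mul, Finset.sum_mul]
  refine Finset.sum_le_sum fun i hi => (h i x f).trans ?_
  have h1 : (1 + ‖x‖) ^ N i ≤ (1 + ‖x‖) ^ t.sup N :=
    pow_le_pow_right₀ (by linarith [norm_nonneg x]) (Finset.le_sup hi)
  have h2 : sumSeminorm (s i) f ≤ sumSeminorm (t.biUnion s) f :=
    Finset.sum_le_sum_of_subset_of_nonneg (Finset.subset_biUnion_of_mem s hi)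
      fun _ _ _ => apply_nonneg _ _
  have := hC i
  have := sumSeminorm_nonneg (s i) f
  gcongr

theorem PolyBounded.comp (hA : PolyBounded A) (hB : PolyBounded B) :
    PolyBounded fun x f => A x (B x f) := by
  intro k l
  obtain ⟨s, C, N, hC, h⟩ := hA k l
  obtain ⟨s', C', N', hC', h'⟩ := hB.sumSeminorm_le s
  refine ⟨s', C * C', N + N', by positivity, fun x f => (h x _).trans ?_⟩
  calc C * (1 + ‖x‖) ^ N * sumSeminorm s (B x f)
      ≤ C * (1 + ‖x‖) ^ N * (C' * (1 + ‖x‖) ^ N' * sumSeminorm s' f) := by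
        gcongr
        exact h' x f
    _ = C * C' * (1 + ‖x‖) ^ (N + N') * sumSeminorm s' f := by ring

theorem polyBounded_const (A : 𝓢(V, ℂ) →L[ℂ] 𝓢(V, ℂ)) :
    PolyBounded fun (_ : X) f => A f := by
  intro k l
  obtain ⟨s, C, hC, h⟩ := exists_seminorm_le_sumSeminorm A k l
  exact ⟨s, C, 0, hC, fun x f => by simpa using h f⟩

theorem PolyBounded.comp_param {A : Y → 𝓢(V, ℂ) → 𝓢(V, ℂ)} (hA : PolyBounded A) {u : X → Y}
    (hu : ∀ x, ‖u x‖ ≤ ‖x‖) : PolyBounded fun x f => A (u x) f := by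
  intro k l
  obtain ⟨s, C, N, hC, h⟩ := hA k l
  refine ⟨s, C, N, hC, fun x f => (h (u x) f).trans ?_⟩
  have := sumSeminorm_nonneg s f
  have := hu x
  gcongr

end PolyBounded

theorem one_add_norm_le_mul {V : Type*} [SeminormedAddCommGroup V] (t x : V) :
    1 + ‖t‖ ≤ (1 + ‖x‖) * (1 + ‖t - x‖) := by
  have h1 : ‖t‖ ≤ ‖x‖ + ‖t - x‖ := by
    simpa using norm_add_le x (t - x)
  nlinarith [norm_nonneg x, norm_nonneg (t - x)]

theorem polyBounded_translation :
    PolyBounded fun (x : RR d) (f : 𝓢(RR d, ℂ)) => SchwartzMap.compSubConstCLM ℂ x f := by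
  intro k l
  refine ⟨Finset.Iic (k, l), 2 ^ k, k, by positivity, fun x f => ?_⟩
  refine SchwartzMap.seminorm_le_bound ℂ k l _
    (mul_nonneg (by positivity) (sumSeminorm_nonneg _ _)) fun t => ?_
  have e : iteratedFDeriv ℝ l (⇑(SchwartzMap.compSubConstCLM ℂ x f)) t =
      iteratedFDeriv ℝ l f (t - x) := iteratedFDeriv_comp_sub l x t
  rw [e]
  have h1 : ‖t‖ ^ k ≤ (1 + ‖x‖) ^ k * (1 + ‖t - x‖) ^ k := by
    rw [← mul_pow]
    gcongr
    linarith [one_add_norm_le_mul t x]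
  calc ‖t‖ ^ k * ‖iteratedFDeriv ℝ l f (t - x)‖
      ≤ (1 + ‖x‖) ^ k * (1 + ‖t - x‖) ^ k * ‖iteratedFDeriv ℝ l f (t - x)‖ := by gcongr
    _ = (1 + ‖x‖) ^ k * ((1 + ‖t - x‖) ^ k * ‖iteratedFDeriv ℝ l f (t - x)‖) := by ring
    _ ≤ (1 + ‖x‖) ^ k * (2 ^ k * sumSeminorm (Finset.Iic (k, l)) f) :=
        mul_le_mul_of_nonneg_left (one_add_norm_pow_mul_le k l f _) (by positivity)
    _ = 2 ^ k * (1 + ‖x‖) ^ k * sumSeminorm (Finset.Iic (k, l)) f := by ring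

/-- For `‖y‖ ≤ 1`, the mean value theorem bounds `f(· - y) - f` by a multiple of `‖y‖`. -/
theorem seminorm_translation_sub_le (k l : ℕ) (f : 𝓢(RR d, ℂ)) {y : RR d} (hy : ‖y‖ ≤ 1) :
    SchwartzMap.seminorm ℂ k l (SchwartzMap.compSubConstCLM ℂ y f - f) ≤
      2 ^ k * sumSeminorm (Finset.Iic (k, l + 1)) f * ‖y‖ := by
  refine SchwartzMap.seminorm_le_bound ℂ k l _
    (mul_nonneg (mul_nonneg (by positivity) (sumSeminorm_nonneg _ _)) (norm_nonneg _)) fun t => ?_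
  have e : iteratedFDeriv ℝ l (⇑(SchwartzMap.compSubConstCLM ℂ y f - f)) t =
      iteratedFDeriv ℝ l f (t - y) - iteratedFDeriv ℝ l f t := by
    have h1 : iteratedFDeriv ℝ l (⇑(SchwartzMap.compSubConstCLM ℂ y f)) t =
      iteratedFDeriv ℝ l f (t - y) := iteratedFDeriv_comp_sub l y t
    rw [← h1]
    exact iteratedFDeriv_sub_apply
      ((SchwartzMap.compSubConstCLM ℂ y f).smooth l).contDiffAt (f.smooth l).contDiffAt
  rw [e]
  have hdiff : Differentiable ℝ (iteratedFDeriv ℝ l f) :=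
    (f.smooth ⊤).differentiable_iteratedFDeriv (by exact_mod_cast WithTop.coe_lt_top l)
  have hmv := Convex.norm_image_sub_le_of_norm_fderiv_le (𝕜 := ℝ)
    (f := fun u => (‖t‖ ^ k : ℝ) • iteratedFDeriv ℝ l f u)
    (C := 2 ^ k * sumSeminorm (Finset.Iic (k, l + 1)) f) (s := Metric.closedBall t 1)
    (x := t) (y := t - y) (fun u _ => (hdiff u).fun_const_smul _) (fun u hu => ?_)
    (convex_closedBall _ _) (Metric.mem_closedBall_self zero_le_one) (by simpa using hy)
  · simpa [← smul_sub, norm_smul] using hmv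
  · rw [fderiv_fun_const_smul (hdiff u), norm_smul, norm_fderiv_iteratedFDeriv]
    refine le_trans ?_ (one_add_norm_pow_mul_le k (l + 1) f u)
    have h2 : ‖t‖ ≤ 1 + ‖u‖ := by
      have h3 : ‖t - u‖ ≤ 1 := by
        rw [← dist_eq_norm, dist_comm]; exact Metric.mem_closedBall.mp hu
      linarith [norm_le_norm_add_norm_sub' t u]
    rw [norm_pow, norm_norm]
    gcongr

theorem continuous_translation (f : 𝓢(RR d, ℂ)) :
    Continuous fun x : RR d => SchwartzMap.compSubConstCLM ℂ x f := by
  have h0 : Filter.Tendsto (fun y : RR d => SchwartzMap.compSubConstCLM ℂ y f) (nhds 0)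
      (nhds f) := by
    rw [(schwartz_withSeminorms ℂ (RR d) ℂ).tendsto_nhds]
    rintro ⟨k, l⟩ ε hε
    have h1 : Filter.Tendsto (fun y : RR d => 2 ^ k * sumSeminorm (Finset.Iic (k, l + 1)) f * ‖y‖)
        (nhds 0) (nhds 0) := by
      have : Continuous fun y : RR d => 2 ^ k * sumSeminorm (Finset.Iic (k, l + 1)) f * ‖y‖ := by
        fun_prop
      simpa using this.tendsto 0
    filter_upwards [h1.eventually (gt_mem_nhds hε), Metric.closedBall_mem_nhds (0 : RR d) one_pos]
      with y hy hy1
    exact (seminorm_translation_sub_le k l f (by simpa using hy1)).trans_lt hy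
  refine continuous_iff_continuousAt.mpr fun x₀ => ?_
  have h1 : Filter.Tendsto (fun x : RR d => x - x₀) (nhds x₀) (nhds 0) := by
    have : Continuous fun x : RR d => x - x₀ := by fun_prop
    simpa using this.tendsto x₀
  have h2 := ((SchwartzMap.compSubConstCLM ℂ x₀ : 𝓢(RR d, ℂ) →L[ℂ] 𝓢(RR d, ℂ)).continuous.tendsto
    f).comp (h0.comp h1)
  refine h2.congr fun x => ?_
  simp

/-! ### Modulations under the Fourier transform -/

open FourierTransform in
theorem fourier_modulation (ω : RR d) (f : 𝓢(RR d, ℂ)) :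
    𝓕 (SchwartzMap.smulLeftCLM ℂ (character ω) f) = SchwartzMap.compSubConstCLM ℂ ω (𝓕 f) := by
  ext ξ
  rw [SchwartzMap.compSubConstCLM_apply, SchwartzMap.fourier_coe, SchwartzMap.fourier_coe,
    Real.fourier_eq', Real.fourier_eq']
  refine integral_congr_ae (Filter.Eventually.of_forall fun t => ?_)
  simp only [SchwartzMap.smulLeftCLM_apply_apply (hasTemperateGrowth_character ω), smul_eq_mul,
    character]
  rw [← mul_assoc, ← Complex.exp_add]
  congr 2
  rw [inner_sub_right, real_inner_comm t ω]
  push_cast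
  ring

open FourierTransform in
/-- Modulations are translations conjugated by the Fourier transform, so that their seminorm bounds
and their continuity follow from those of translations. -/
theorem modulation_eq (ω : RR d) (f : 𝓢(RR d, ℂ)) :
    SchwartzMap.smulLeftCLM ℂ (character ω) f =
      𝓕⁻ (SchwartzMap.compSubConstCLM ℂ ω (𝓕 f)) := by
  rw [← fourier_modulation, FourierPair.fourierInv_fourier_eq]

open FourierTransform in
theorem polyBounded_modulation :
    PolyBounded fun (ω : RR d) (f : 𝓢(RR d, ℂ)) =>
      SchwartzMap.smulLeftCLM ℂ (character ω) f := by
  simp_rw [modulation_eq]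
  exact (polyBounded_const (fourierInvCLM ℂ 𝓢(RR d, ℂ))).comp
    (polyBounded_translation.comp (polyBounded_const (fourierCLM ℂ 𝓢(RR d, ℂ))))

open FourierTransform in
theorem continuous_modulation (f : 𝓢(RR d, ℂ)) :
    Continuous fun ω : RR d => SchwartzMap.smulLeftCLM ℂ (character ω) f := by
  simp_rw [modulation_eq]
  exact (fourierInvCLM ℂ 𝓢(RR d, ℂ)).continuous.comp (continuous_translation (𝓕 f))

theorem polyBounded_shift :
    PolyBounded fun (z : RR d × RR d) (f : 𝓢(RR d, ℂ)) => shift z f :=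
  (polyBounded_modulation.comp_param (u := fun z : RR d × RR d => z.2) norm_snd_le).comp
    (polyBounded_translation.comp_param (u := fun z : RR d × RR d => z.1) norm_fst_le)

/-- Time-frequency shifts act continuously on the Schwartz space. -/
theorem continuous_shift (f : 𝓢(RR d, ℂ)) : Continuous fun z : RR d × RR d => shift z f := by
  refine continuous_iff_continuousAt.mpr fun z₀ => ?_
  set T : RR d → 𝓢(RR d, ℂ) := fun x => SchwartzMap.compSubConstCLM ℂ x f with hT
  rw [ContinuousAt, (schwartz_withSeminorms ℂ (RR d) ℂ).tendsto_nhds]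
  rintro ⟨k, l⟩ ε hε
  obtain ⟨s, C, N, hC, h⟩ := polyBounded_modulation (d := d) k l
  have hsum : Continuous fun u : 𝓢(RR d, ℂ) => sumSeminorm s u :=
    continuous_finsetSum _ fun i _ => (schwartz_withSeminorms ℂ (RR d) ℂ).continuous_seminorm i
  have hp : Continuous (SchwartzMap.seminorm ℂ k l : 𝓢(RR d, ℂ) → ℝ) :=
    (schwartz_withSeminorms ℂ (RR d) ℂ).continuous_seminorm (k, l)
  have h1 : Continuous fun z : RR d × RR d =>
      C * (1 + ‖z.2‖) ^ N * sumSeminorm s (T z.1 - T z₀.1) +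
        SchwartzMap.seminorm ℂ k l (SchwartzMap.smulLeftCLM ℂ (character z.2) (T z₀.1) -
          SchwartzMap.smulLeftCLM ℂ (character z₀.2) (T z₀.1)) := by
    refine Continuous.add (Continuous.mul (by fun_prop) (hsum.comp ?_)) (hp.comp ?_)
    · exact ((continuous_translation f).comp continuous_fst).sub continuous_const
    · exact ((continuous_modulation (T z₀.1)).comp continuous_snd).sub continuous_const
  have h2 := h1.tendsto z₀
  have hz : sumSeminorm s (0 : 𝓢(RR d, ℂ)) = 0 := by simp [sumSeminorm]
  simp only [sub_self, hz, map_zero, mul_zero, add_zero] at h2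
  filter_upwards [h2.eventually (gt_mem_nhds hε)] with z hz
  refine lt_of_le_of_lt ?_ hz
  have e : shift z f - shift z₀ f =
      SchwartzMap.smulLeftCLM ℂ (character z.2) (T z.1 - T z₀.1) +
        (SchwartzMap.smulLeftCLM ℂ (character z.2) (T z₀.1) -
          SchwartzMap.smulLeftCLM ℂ (character z₀.2) (T z₀.1)) := by
    rw [map_sub, sub_add_sub_cancel]; rfl
  rw [e]
  refine (map_add_le_add _ _ _).trans ?_
  gcongr
  · exact h z.2 _
  · exact le_rfl

/-! ### The short-time Fourier transform of Schwartz functions -/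

theorem norm_character (ω t : RR d) : ‖character ω t‖ = 1 := by
  rw [character, show (2 * (Real.pi : ℂ) * Complex.I * ((inner ℝ ω t : ℝ) : ℂ)) =
    ((2 * Real.pi * inner ℝ ω t : ℝ) : ℂ) * Complex.I by push_cast; ring]
  exact Complex.norm_exp_ofReal_mul_I _

theorem norm_shift_apply (z : RR d × RR d) (g : 𝓢(RR d, ℂ)) (t : RR d) :
    ‖shift z g t‖ = ‖g (t - z.1)‖ := by
  rw [shift_apply, norm_mul, norm_character, one_mul]

theorem stft_coe (g f : 𝓢(RR d, ℂ)) (z : RR d × RR d) :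
    stft g (f : 𝓢'(RR d, ℂ)) z = ∫ t, f t * conj (shift z g t) := by
  rw [stft, SchwartzMap.coe_apply]
  simp [conjS_apply, mul_comm]

theorem continuous_conjS : Continuous (conjS : 𝓢(RR d, ℂ) → 𝓢(RR d, ℂ)) :=
  (SchwartzMap.postcompCLM (𝕜 := ℝ) (Complex.conjCLE : ℂ →L[ℝ] ℂ)).continuous

theorem continuous_stft (g : 𝓢(RR d, ℂ)) (ψ : 𝓢'(RR d, ℂ)) : Continuous (stft g ψ) :=
  (ContinuousLinearMap.continuous (ψ : 𝓢(RR d, ℂ) →L[ℂ] ℂ)).comp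
    (continuous_conjS.comp (continuous_shift g))

theorem seminorm_conjS (k l : ℕ) (f : 𝓢(RR d, ℂ)) :
    SchwartzMap.seminorm ℂ k l (conjS f) ≤ SchwartzMap.seminorm ℂ k l f := by
  refine SchwartzMap.seminorm_le_bound ℂ k l _ (apply_nonneg _ _) fun x => ?_
  have : ‖iteratedFDeriv ℝ l (⇑(conjS f)) x‖ = ‖iteratedFDeriv ℝ l f x‖ :=
    Complex.conjLIE.norm_iteratedFDeriv_comp_left f x l
  rw [this]
  exact SchwartzMap.le_seminorm ℂ k l f x

theorem sumSeminorm_conjS (s : Finset (ℕ × ℕ)) (f : 𝓢(RR d, ℂ)) :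
    sumSeminorm s (conjS f) ≤ sumSeminorm s f :=
  Finset.sum_le_sum fun i _ => seminorm_conjS i.1 i.2 f

theorem distribution_smul (ψ : 𝓢'(RR d, ℂ)) (c : ℂ) (f : 𝓢(RR d, ℂ)) :
    ψ (c • f) = c * ψ f :=
  map_smul (ψ : 𝓢(RR d, ℂ) →L[ℂ] ℂ) c f

theorem conjS_conjS (f : 𝓢(RR d, ℂ)) : conjS (conjS f) = f := by
  ext t; simp [conjS_apply]

/-! ### Decay of the short-time Fourier transform -/

theorem integrable_inv_one_add_norm_pow :
    Integrable fun x : RR d => ((1 + ‖x‖) ^ (d + 1))⁻¹ := by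
  have hi := integrable_one_add_norm (E := RR d) (μ := volume) (r := d + 1) (by simp)
  refine hi.congr (Filter.Eventually.of_forall fun x => ?_)
  have : (0 : ℝ) ≤ 1 + ‖x‖ := by positivity
  dsimp only
  rw [Real.rpow_neg this]
  norm_cast

theorem exists_integral_mul_translate_le (d m : ℕ) :
    ∃ C : ℝ, 0 ≤ C ∧ ∀ (f g : 𝓢(RR d, ℂ)) (x : RR d),
      (1 + ‖x‖) ^ m * ∫ t, ‖f t‖ * ‖g (t - x)‖ ≤
        C * sumSeminorm (Finset.Iic (m + (d + 1), 0)) f * sumSeminorm (Finset.Iic (m, 0)) g := by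
  set J : ℝ := ∫ t : RR d, ((1 + ‖t‖) ^ (d + 1))⁻¹ with hJ
  refine ⟨2 ^ (m + (d + 1)) * 2 ^ m * J,
    mul_nonneg (by positivity) (integral_nonneg fun t => by positivity), fun f g x => ?_⟩
  set a := sumSeminorm (Finset.Iic (m + (d + 1), 0)) f
  set b := sumSeminorm (Finset.Iic (m, 0)) g
  have ha : 0 ≤ a := sumSeminorm_nonneg _ _
  have hb : 0 ≤ b := sumSeminorm_nonneg _ _
  have key : ∀ t, (1 + ‖x‖) ^ m * (‖f t‖ * ‖g (t - x)‖) ≤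
      (2 ^ (m + (d + 1)) * a) * (2 ^ m * b) * ((1 + ‖t‖) ^ (d + 1))⁻¹ := by
    intro t
    have h1 := one_add_norm_pow_mul_norm_le (m + (d + 1)) f t
    have h2 := one_add_norm_pow_mul_norm_le m g (t - x)
    have h3 : (1 + ‖x‖) ^ m ≤ (1 + ‖t‖) ^ m * (1 + ‖t - x‖) ^ m := by
      rw [← mul_pow]
      gcongr
      rw [norm_sub_rev]
      exact one_add_norm_le_mul x t
    rw [← div_eq_mul_inv, le_div_iff₀ (by positivity)]
    calc (1 + ‖x‖) ^ m * (‖f t‖ * ‖g (t - x)‖) * (1 + ‖t‖) ^ (d + 1)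
        ≤ ((1 + ‖t‖) ^ m * (1 + ‖t - x‖) ^ m) * (‖f t‖ * ‖g (t - x)‖) * (1 + ‖t‖) ^ (d + 1) := by
          gcongr
      _ = ((1 + ‖t‖) ^ (m + (d + 1)) * ‖f t‖) * ((1 + ‖t - x‖) ^ m * ‖g (t - x)‖) := by ring
      _ ≤ (2 ^ (m + (d + 1)) * a) * (2 ^ m * b) := by gcongr
  rw [← integral_const_mul]
  refine (integral_mono_of_nonneg (Filter.Eventually.of_forall fun t => by positivity)
    (integrable_inv_one_add_norm_pow.const_mul _) (Filter.Eventually.of_forall key)).trans_eq ?_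
  rw [integral_const_mul, ← hJ]
  ring

theorem norm_stft_coe_le (g f : 𝓢(RR d, ℂ)) (z : RR d × RR d) :
    ‖stft g (f : 𝓢'(RR d, ℂ)) z‖ ≤ ∫ t, ‖f t‖ * ‖g (t - z.1)‖ := by
  rw [stft_coe]
  refine (norm_integral_le_integral_norm _).trans_eq ?_
  simp [norm_shift_apply]

open FourierTransform in
theorem norm_fourier_translate (g : 𝓢(RR d, ℂ)) (x s : RR d) :
    ‖𝓕 (SchwartzMap.compSubConstCLM ℂ x g) s‖ = ‖𝓕 g s‖ := by
  rw [SchwartzMap.fourier_coe, SchwartzMap.fourier_coe, Real.fourier_eq', Real.fourier_eq',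
    ← integral_add_right_eq_self _ x]
  have : ∀ t : RR d, Complex.exp (↑(-2 * Real.pi * inner ℝ (t + x) s) * Complex.I) •
      SchwartzMap.compSubConstCLM ℂ x g (t + x) =
      Complex.exp (↑(-2 * Real.pi * inner ℝ x s) * Complex.I) *
        (Complex.exp (↑(-2 * Real.pi * inner ℝ t s) * Complex.I) • g t) := by
    intro t
    rw [SchwartzMap.compSubConstCLM_apply, add_sub_cancel_right, smul_eq_mul, smul_eq_mul,
      ← mul_assoc, ← Complex.exp_add, inner_add_left]
    congr 2
    push_cast
    ring
  simp_rw [this]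
  rw [integral_const_mul, norm_mul, Complex.norm_exp_ofReal_mul_I, one_mul]

open FourierTransform in
/-- By Plancherel's theorem the short-time Fourier transform can also be computed on the Fourier
side, where the frequency variable acts by translation. -/
theorem norm_stft_coe_le_fourier (g f : 𝓢(RR d, ℂ)) (z : RR d × RR d) :
    ‖stft g (f : 𝓢'(RR d, ℂ)) z‖ ≤ ∫ s, ‖𝓕 f s‖ * ‖𝓕 g (s - z.2)‖ := by
  have h1 : stft g (f : 𝓢'(RR d, ℂ)) z = ∫ s, inner ℂ (𝓕 (shift z g) s) (𝓕 f s) := by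
    rw [SchwartzMap.integral_inner_fourier_fourier, stft_coe]
    simp
  rw [h1]
  refine (norm_integral_le_integral_norm _).trans_eq ?_
  refine integral_congr_ae (Filter.Eventually.of_forall fun s => ?_)
  have h2 : ‖𝓕 (shift z g) s‖ = ‖𝓕 g (s - z.2)‖ := by
    have : 𝓕 (shift z g) =
        SchwartzMap.compSubConstCLM ℂ z.2 (𝓕 (SchwartzMap.compSubConstCLM ℂ z.1 g)) :=
      fourier_modulation z.2 _
    rw [this, SchwartzMap.compSubConstCLM_apply, norm_fourier_translate]
  simp only [RCLike.inner_apply, norm_mul, RCLike.norm_conj, h2]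

/-- The short-time Fourier transform of a Schwartz function decays rapidly in both variables, with
constants controlled by Schwartz seminorms of the function. -/
theorem exists_stft_decay (g : 𝓢(RR d, ℂ)) (n : ℕ) :
    ∃ (s : Finset (ℕ × ℕ)) (C : ℝ), 0 ≤ C ∧ ∀ (f : 𝓢(RR d, ℂ)) (z : RR d × RR d),
      ‖stft g (f : 𝓢'(RR d, ℂ)) z‖ * ((1 + ‖z.1‖) ^ n * (1 + ‖z.2‖) ^ n) ≤
        C * sumSeminorm s f := by
  classical
  obtain ⟨C₁, hC₁, h₁⟩ := exists_integral_mul_translate_le d (2 * n)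
  set u : Finset (ℕ × ℕ) := Finset.Iic (2 * n + (d + 1), 0)
  obtain ⟨s, C₂, hC₂, h₂⟩ := exists_sumSeminorm_le_sumSeminorm
    (FourierTransform.fourierCLM ℂ 𝓢(RR d, ℂ)) u
  set K₁ := C₁ * sumSeminorm (Finset.Iic (2 * n, 0)) g with hK₁
  set K₂ := C₁ * C₂ * sumSeminorm (Finset.Iic (2 * n, 0)) (FourierTransform.fourier g) with hK₂
  have hK₁0 : 0 ≤ K₁ := mul_nonneg hC₁ (sumSeminorm_nonneg _ _)
  have hK₂0 : 0 ≤ K₂ := mul_nonneg (mul_nonneg hC₁ hC₂) (sumSeminorm_nonneg _ _)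
  refine ⟨u ∪ s, K₁ + K₂, by positivity, fun f z => ?_⟩
  have hu : sumSeminorm u f ≤ sumSeminorm (u ∪ s) f :=
    Finset.sum_le_sum_of_subset_of_nonneg Finset.subset_union_left fun _ _ _ => apply_nonneg _ _
  have hs : sumSeminorm s f ≤ sumSeminorm (u ∪ s) f :=
    Finset.sum_le_sum_of_subset_of_nonneg Finset.subset_union_right fun _ _ _ => apply_nonneg _ _
  set R := sumSeminorm (u ∪ s) f
  have hR : 0 ≤ R := sumSeminorm_nonneg _ _
  have e₁ : (1 + ‖z.1‖) ^ (2 * n) * ‖stft g (f : 𝓢'(RR d, ℂ)) z‖ ≤ (K₁ + K₂) * R := by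
    calc (1 + ‖z.1‖) ^ (2 * n) * ‖stft g (f : 𝓢'(RR d, ℂ)) z‖
        ≤ (1 + ‖z.1‖) ^ (2 * n) * ∫ t, ‖f t‖ * ‖g (t - z.1)‖ := by
          gcongr
          exact norm_stft_coe_le g f z
      _ ≤ C₁ * sumSeminorm u f * sumSeminorm (Finset.Iic (2 * n, 0)) g := h₁ f g z.1
      _ = K₁ * sumSeminorm u f := by rw [hK₁]; ring
      _ ≤ K₁ * R := by gcongr
      _ ≤ (K₁ + K₂) * R := by nlinarith [mul_nonneg hK₂0 hR]
  have e₂ : (1 + ‖z.2‖) ^ (2 * n) * ‖stft g (f : 𝓢'(RR d, ℂ)) z‖ ≤ (K₁ + K₂) * R := by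
    calc (1 + ‖z.2‖) ^ (2 * n) * ‖stft g (f : 𝓢'(RR d, ℂ)) z‖
        ≤ (1 + ‖z.2‖) ^ (2 * n) * ∫ t, ‖FourierTransform.fourier f t‖ *
            ‖FourierTransform.fourier g (t - z.2)‖ := by
          gcongr
          exact norm_stft_coe_le_fourier g f z
      _ ≤ C₁ * sumSeminorm u (FourierTransform.fourier f) *
            sumSeminorm (Finset.Iic (2 * n, 0)) (FourierTransform.fourier g) :=
          h₁ (FourierTransform.fourier f) (FourierTransform.fourier g) z.2
      _ ≤ C₁ * (C₂ * sumSeminorm s f) *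
            sumSeminorm (Finset.Iic (2 * n, 0)) (FourierTransform.fourier g) := by
          have := sumSeminorm_nonneg (Finset.Iic (2 * n, 0)) (FourierTransform.fourier g)
          gcongr
          exact h₂ f
      _ = K₂ * sumSeminorm s f := by rw [hK₂]; ring
      _ ≤ K₂ * R := by gcongr
      _ ≤ (K₁ + K₂) * R := by nlinarith [mul_nonneg hK₁0 hR]
  -- the product of the two bounds is the square of the claim
  refine le_of_sq_le_sq ?_ (by positivity)
  calc (‖stft g (f : 𝓢'(RR d, ℂ)) z‖ * ((1 + ‖z.1‖) ^ n * (1 + ‖z.2‖) ^ n)) ^ 2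
      = ((1 + ‖z.1‖) ^ (2 * n) * ‖stft g (f : 𝓢'(RR d, ℂ)) z‖) *
          ((1 + ‖z.2‖) ^ (2 * n) * ‖stft g (f : 𝓢'(RR d, ℂ)) z‖) := by ring
    _ ≤ ((K₁ + K₂) * R) * ((K₁ + K₂) * R) := by gcongr
    _ = ((K₁ + K₂) * R) ^ 2 := by ring

theorem integrable_inv_phase :
    Integrable fun z : RR d × RR d =>
      ((1 + ‖z.1‖) ^ (d + 1))⁻¹ * ((1 + ‖z.2‖) ^ (d + 1))⁻¹ :=
  integrable_inv_one_add_norm_pow.mul_prod integrable_inv_one_add_norm_pow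

/-- The short-time Fourier transform of a Schwartz function is integrable against any polynomial
weight. -/
theorem integrable_norm_stft_mul_pow (g f : 𝓢(RR d, ℂ)) (N : ℕ) :
    Integrable fun z : RR d × RR d => ‖stft g (f : 𝓢'(RR d, ℂ)) z‖ * (1 + ‖z‖) ^ N := by
  obtain ⟨s, C, hC, h⟩ := exists_stft_decay g (N + (d + 1))
  refine (integrable_inv_phase.const_mul (C * sumSeminorm s f)).mono'
    (Continuous.aestronglyMeasurable ((continuous_stft g _).norm.mul (by fun_prop)))
    (Filter.Eventually.of_forall fun z => ?_)
  have hz : 1 + ‖z‖ ≤ (1 + ‖z.1‖) * (1 + ‖z.2‖) := by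
    have : ‖z‖ ≤ ‖z.1‖ + ‖z.2‖ := by
      rw [Prod.norm_def]
      exact max_le (by linarith [norm_nonneg z.2]) (by linarith [norm_nonneg z.1])
    nlinarith [norm_nonneg z.1, norm_nonneg z.2]
  rw [Real.norm_of_nonneg (by positivity), ← mul_inv, ← div_eq_mul_inv,
    le_div_iff₀ (by positivity)]
  calc ‖stft g (f : 𝓢'(RR d, ℂ)) z‖ * (1 + ‖z‖) ^ N *
        ((1 + ‖z.1‖) ^ (d + 1) * (1 + ‖z.2‖) ^ (d + 1))
      ≤ ‖stft g (f : 𝓢'(RR d, ℂ)) z‖ * ((1 + ‖z.1‖) * (1 + ‖z.2‖)) ^ N *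
        ((1 + ‖z.1‖) ^ (d + 1) * (1 + ‖z.2‖) ^ (d + 1)) := by gcongr
    _ = ‖stft g (f : 𝓢'(RR d, ℂ)) z‖ *
        ((1 + ‖z.1‖) ^ (N + (d + 1)) * (1 + ‖z.2‖) ^ (N + (d + 1))) := by
        rw [mul_pow]; ring
    _ ≤ C * sumSeminorm s f := h f z

/-! ### The inversion formula -/

open FourierTransform in
/-- The inversion formula for Schwartz functions, pointwise: the inner integral over frequencies is
Fourier inversion, the outer one over times is the square norm of the window. -/
theorem integral_stft_mul_shift (g f : 𝓢(RR d, ℂ)) (t : RR d) :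
    ∫ z, stft g (f : 𝓢'(RR d, ℂ)) z * shift z g t = ((∫ s, ‖g s‖ ^ 2 : ℝ) : ℂ) * f t := by
  obtain ⟨M, hM⟩ : ∃ M, ∀ s, ‖g s‖ ≤ M := ⟨_, SchwartzMap.norm_le_seminorm ℂ g⟩
  have hM0 : 0 ≤ M := (norm_nonneg _).trans (hM 0)
  have hVc := continuous_stft g (f : 𝓢'(RR d, ℂ))
  have hsc : Continuous fun z : RR d × RR d => shift z g t := by
    simp_rw [shift_apply, character]
    fun_prop
  have hV := integrable_norm_stft_mul_pow g f 0
  simp only [pow_zero, mul_one] at hV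
  have hint : Integrable (fun z : RR d × RR d => stft g (f : 𝓢'(RR d, ℂ)) z * shift z g t) := by
    refine (hV.mul_const M).mono' (hVc.mul hsc).aestronglyMeasurable
      (Filter.Eventually.of_forall fun z => ?_)
    rw [norm_mul, norm_shift_apply]
    gcongr
    exact hM _
  rw [Measure.volume_eq_prod, integral_prod _ hint]
  have inner_eq : ∀ x, ∫ ω, stft g (f : 𝓢'(RR d, ℂ)) (x, ω) * shift (x, ω) g t =
      f t * ((‖g (t - x)‖ ^ 2 : ℝ) : ℂ) := by
    intro x
    set u : RR d → ℂ := fun s => f s * conj (g (s - x)) with hu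
    have hgx : Continuous fun s => g (s - x) := g.continuous.comp (by fun_prop)
    have huc : Continuous u := f.continuous.mul (Complex.continuous_conj.comp hgx)
    have hui : Integrable u := by
      refine (f.integrable.norm.mul_const M).mono' huc.aestronglyMeasurable
        (Filter.Eventually.of_forall fun s => ?_)
      rw [hu, norm_mul, RCLike.norm_conj]
      gcongr
      exact hM _
    have hFu : 𝓕 u = fun ω => stft g (f : 𝓢'(RR d, ℂ)) (x, ω) := by
      ext ω
      rw [Real.fourier_eq', stft_coe]
      refine integral_congr_ae (Filter.Eventually.of_forall fun s => ?_)
      simp only [hu, shift_apply, map_mul, character, smul_eq_mul, ← Complex.exp_conj,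
        Complex.conj_I, Complex.conj_ofReal, map_ofNat]
      rw [real_inner_comm ω s, mul_left_comm]
      congr 3
      push_cast
      ring
    have hFi : Integrable (𝓕 u) := by
      obtain ⟨s, C, hC, h⟩ := exists_stft_decay g (d + 1)
      rw [hFu]
      refine (integrable_inv_one_add_norm_pow.const_mul (C * sumSeminorm s f)).mono'
        (hVc.comp (by fun_prop)).aestronglyMeasurable (Filter.Eventually.of_forall fun ω => ?_)
      rw [← div_eq_mul_inv, le_div_iff₀ (by positivity)]
      refine le_trans ?_ (h f (x, ω))
      gcongr
      have h1 : 1 ≤ (1 + ‖x‖) ^ (d + 1) := one_le_pow₀ (by linarith [norm_nonneg x])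
      have h2 : 0 ≤ (1 + ‖ω‖) ^ (d + 1) := by positivity
      dsimp only
      nlinarith
    have hinv := congrFun (huc.fourierInv_fourier_eq hui hFi) t
    rw [Real.fourierInv_eq', hFu] at hinv
    have : ∀ ω, stft g (f : 𝓢'(RR d, ℂ)) (x, ω) * shift (x, ω) g t =
        Complex.exp (↑(2 * Real.pi * inner ℝ ω t) * Complex.I) •
          stft g (f : 𝓢'(RR d, ℂ)) (x, ω) * g (t - x) := by
      intro ω
      have he : Complex.exp (↑(2 * Real.pi * inner ℝ ω t) * Complex.I) = character ω t := by
        rw [character]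
        congr 1
        push_cast
        ring
      rw [shift_apply, he, smul_eq_mul]
      ring
    simp_rw [this]
    rw [integral_mul_const, hinv, hu]
    simp only
    rw [mul_assoc, ← Complex.normSq_eq_conj_mul_self, Complex.normSq_eq_norm_sq]
  simp_rw [inner_eq]
  rw [integral_const_mul, mul_comm, integral_complex_ofReal,
    integral_sub_left_eq_self (fun s => ‖g s‖ ^ 2) volume t]

/-- The inversion formula for tempered distributions: the complex conjugate of the inversion formula
for the Schwartz function `f`, to which the distribution is applied under the integral sign. -/
theorem integral_stft_mul_conj_stft (g f : 𝓢(RR d, ℂ)) (ψ : 𝓢'(RR d, ℂ)) :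
    ∫ z, stft g ψ z * conj (stft g (f : 𝓢'(RR d, ℂ)) z) =
      ((∫ s, ‖g s‖ ^ 2 : ℝ) : ℂ) * ψ (conjS f) := by
  set Ψ : RR d × RR d → 𝓢(RR d, ℂ) := fun z =>
    conj (stft g (f : 𝓢'(RR d, ℂ)) z) • conjS (shift z g) with hΨ
  have hc : Continuous Ψ :=
    (Complex.continuous_conj.comp (continuous_stft g _)).smul
      (continuous_conjS.comp (continuous_shift g))
  have hi : ∀ k l, Integrable fun z => SchwartzMap.seminorm ℂ k l (Ψ z) := by
    intro k l
    obtain ⟨s, C, N, hC, h⟩ := polyBounded_shift (d := d) k l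
    refine ((integrable_norm_stft_mul_pow g f N).const_mul (C * sumSeminorm s g)).mono'
      (((schwartz_withSeminorms ℂ (RR d) ℂ).continuous_seminorm (k, l)).comp
        hc).aestronglyMeasurable
      (Filter.Eventually.of_forall fun z => ?_)
    rw [Real.norm_of_nonneg (apply_nonneg _ _), hΨ, map_smul_eq_mul, RCLike.norm_conj]
    calc ‖stft g (f : 𝓢'(RR d, ℂ)) z‖ * SchwartzMap.seminorm ℂ k l (conjS (shift z g))
        ≤ ‖stft g (f : 𝓢'(RR d, ℂ)) z‖ * (C * (1 + ‖z‖) ^ N * sumSeminorm s g) := by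
          gcongr
          exact (seminorm_conjS k l _).trans (h z g)
      _ = C * sumSeminorm s g * (‖stft g (f : 𝓢'(RR d, ℂ)) z‖ * (1 + ‖z‖) ^ N) := by ring
  have hF : ∀ t, ∫ z, Ψ z t = (((∫ s, ‖g s‖ ^ 2 : ℝ) : ℂ) • conjS f) t := by
    intro t
    have h1 : ∀ z, Ψ z t = conj (stft g (f : 𝓢'(RR d, ℂ)) z * shift z g t) := fun z => by
      simp [hΨ, conjS_apply]
    simp_rw [h1]
    rw [integral_conj, integral_stft_mul_shift, map_mul, Complex.conj_ofReal]
    simp [conjS_apply]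
  have h := (integral_apply_schwartz hc hi hF (ψ : 𝓢(RR d, ℂ) →L[ℂ] ℂ)).2
  refine Eq.trans (integral_congr_ae (Filter.Eventually.of_forall fun z => ?_))
    (h.trans (distribution_smul ψ _ _))
  exact (mul_comm _ _).trans (distribution_smul ψ _ _).symm

/-! ### Covariance of the short-time Fourier transform -/

/-- Instance search finds this for the product of the two Lebesgue measures only, not for `volume`. -/
instance isAddHaarMeasure_volume_phaseSpace :
    (volume : Measure (RR d × RR d)).IsAddHaarMeasure :=
  inferInstanceAs ((volume : Measure (RR d)).prod (volume : Measure (RR d))).IsAddHaarMeasure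

instance isNegInvariant_volume_phaseSpace :
    (volume : Measure (RR d × RR d)).IsNegInvariant :=
  Measure.IsAddHaarMeasure.isNegInvariant_of_regular _

theorem character_add_right (ω s t : RR d) :
    character ω (s + t) = character ω s * character ω t := by
  rw [character, character, character, ← Complex.exp_add, inner_add_right]
  congr 1
  push_cast
  ring

theorem character_mul_conj (ω η t : RR d) :
    character ω t * conj (character η t) = conj (character (η - ω) t) := by
  simp only [character, ← Complex.exp_conj, map_mul, Complex.conj_I, Complex.conj_ofReal, map_ofNat]
  rw [← Complex.exp_add, inner_sub_left]
  congr 1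
  push_cast
  ring

theorem continuous_character_uncurry :
    Continuous fun p : RR d × RR d => character p.1 p.2 := by
  unfold character
  fun_prop

/-- A time-frequency shift of a distribution translates its short-time Fourier transform, up to a
phase factor. -/
theorem stft_shiftD (h : 𝓢(RR d, ℂ)) (u : 𝓢'(RR d, ℂ)) (z w : RR d × RR d) :
    stft h (shiftD z u) w = conj (character (w.2 - z.2) z.1) * stft h u (w - z) := by
  rw [stft, stft, shiftD_apply, ← distribution_smul]
  congr 1
  ext t
  simp only [SchwartzMap.compSubConstCLM_apply, conjS_apply, shift_apply, smul_apply,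
    SchwartzMap.smulLeftCLM_apply_apply (hasTemperateGrowth_character z.2), smul_eq_mul, map_mul,
    sub_neg_eq_add, Prod.snd_sub, Prod.fst_sub]
  rw [← mul_assoc, character_mul_conj, character_add_right, map_mul,
    show t + z.1 - w.1 = t - (w.1 - z.1) by abel]
  ring

theorem norm_stft_shiftD (h : 𝓢(RR d, ℂ)) (u : 𝓢'(RR d, ℂ)) (z w : RR d × RR d) :
    ‖stft h (shiftD z u) w‖ = ‖stft h u (w - z)‖ := by
  rw [stft_shiftD, norm_mul, RCLike.norm_conj, norm_character, one_mul]

theorem enorm_stft_shiftD (h : 𝓢(RR d, ℂ)) (u : 𝓢'(RR d, ℂ)) (z w : RR d × RR d) :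
    ‖stft h (shiftD z u) w‖ₑ = ‖stft h u (w - z)‖ₑ := by
  rw [← ofReal_norm, norm_stft_shiftD, ofReal_norm]

theorem continuous_stft_shiftD (h : 𝓢(RR d, ℂ)) (u : 𝓢'(RR d, ℂ)) :
    Continuous fun p : (RR d × RR d) × (RR d × RR d) => stft h (shiftD p.1 u) p.2 := by
  simp_rw [stft_shiftD]
  refine (Complex.continuous_conj.comp
    (continuous_character_uncurry.comp (f := fun p : (RR d × RR d) × (RR d × RR d) =>
      (p.2.2 - p.1.2, p.1.1)) (by fun_prop))).mul ((continuous_stft h u).comp (by fun_prop))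

theorem shift_zero (f : 𝓢(RR d, ℂ)) : shift 0 f = f := by
  ext t
  simp [shift_apply, character]

/-- Evaluating a time-frequency shift at a test function amounts to evaluating a short-time Fourier
transform whose window is the conjugate test function. -/
theorem stft_conjS_shiftD_zero (u : 𝓢'(RR d, ℂ)) (z : RR d × RR d) (f : 𝓢(RR d, ℂ)) :
    stft (conjS f) (shiftD z u) 0 = shiftD z u f := by
  rw [stft, shift_zero, conjS_conjS]

theorem continuous_shiftD_apply (u : 𝓢'(RR d, ℂ)) (f : 𝓢(RR d, ℂ)) :
    Continuous fun z => shiftD z u f := by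
  simp_rw [← stft_conjS_shiftD_zero]
  exact (continuous_stft_shiftD (conjS f) u).comp (f := fun z => (z, 0)) (by fun_prop)

theorem stft_shift_symm (g h : 𝓢(RR d, ℂ)) (v w : RR d × RR d) :
    conj (stft g (shift w h : 𝓢'(RR d, ℂ)) v) = stft h (shift v g : 𝓢'(RR d, ℂ)) w := by
  rw [stft_coe, stft_coe, ← integral_conj]
  simp [mul_comm]

/-! ### Change of window -/

/-- The square norm `‖g‖²_{L²}` of a window, as a complex number. -/
def windowSq (g : 𝓢(RR d, ℂ)) : ℂ := ((∫ t, ‖g t‖ ^ 2 : ℝ) : ℂ)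

/-- The reproducing constant `‖g‖_{L²}⁻²` of a window, as an extended nonnegative real. For `g ≠ 0`
it is the actual inverse; for `g = 0` it is `0`. -/
def windowConst (g : 𝓢(RR d, ℂ)) : ℝ≥0∞ := ‖(windowSq g)⁻¹‖ₑ

theorem windowSq_ne_zero {g : 𝓢(RR d, ℂ)} (hg : g ≠ 0) : windowSq g ≠ 0 := by
  rw [windowSq, Complex.ofReal_ne_zero]
  intro h0
  have hi : Integrable fun t => ‖g t‖ ^ 2 := (g.memLp 2).integrable_norm_pow (by norm_num)
  rw [integral_eq_zero_iff_of_nonneg (fun t => by positivity) hi] at h0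
  have h1 : (fun t => ‖g t‖ ^ 2) = 0 :=
    Continuous.ae_eq_iff_eq volume (g.continuous.norm.pow 2) continuous_const |>.mp h0
  refine hg (SchwartzMap.ext fun t => ?_)
  simpa using congrFun h1 t

theorem conj_windowSq (g : 𝓢(RR d, ℂ)) : conj (windowSq g) = windowSq g := Complex.conj_ofReal _

theorem windowConst_lt_top (g : 𝓢(RR d, ℂ)) : windowConst g < ∞ := enorm_lt_top

/-- The inversion formula as a bound for the values of a distribution. -/
theorem enorm_apply_conjS_le {g : 𝓢(RR d, ℂ)} (hg : g ≠ 0) (ψ : 𝓢'(RR d, ℂ))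
    (f : 𝓢(RR d, ℂ)) :
    ‖ψ (conjS f)‖ₑ ≤
      windowConst g * ∫⁻ w, ‖stft g ψ w‖ₑ * ‖stft g (f : 𝓢'(RR d, ℂ)) w‖ₑ := by
  have h := integral_stft_mul_conj_stft g f ψ
  rw [← windowSq] at h
  have h1 : ψ (conjS f) =
      (windowSq g)⁻¹ * ∫ z, stft g ψ z * conj (stft g (f : 𝓢'(RR d, ℂ)) z) := by
    rw [h, inv_mul_cancel_left₀ (windowSq_ne_zero hg)]
  rw [h1, enorm_mul, windowConst]
  gcongr
  refine (enorm_integral_le_lintegral_enorm _).trans_eq ?_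
  simp [enorm_mul]

/-- Under a change of window from `g` to `h`, the modulus of the short-time Fourier transform is
dominated by its convolution with the reflection of the rapidly decreasing function `|V_g h|`. -/
theorem enorm_stft_le {g : 𝓢(RR d, ℂ)} (hg : g ≠ 0) (h : 𝓢(RR d, ℂ)) (ψ : 𝓢'(RR d, ℂ))
    (z : RR d × RR d) :
    ‖stft h ψ z‖ₑ ≤
      windowConst g * ∫⁻ w, ‖stft g ψ w‖ₑ * ‖stft g (h : 𝓢'(RR d, ℂ)) (w - z)‖ₑ := by
  refine (enorm_apply_conjS_le hg ψ (shift z h)).trans_eq ?_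
  simp_rw [← shiftD_coe, enorm_stft_shiftD]

theorem exists_enorm_stft_coe_le_phaseWeight (g : 𝓢(RR d, ℂ)) :
    ∃ (s : Finset (ℕ × ℕ)) (C : ℝ), 0 ≤ C ∧ ∀ (f : 𝓢(RR d, ℂ)) (z : RR d × RR d),
      ‖stft g (f : 𝓢'(RR d, ℂ)) z‖ₑ ≤ ENNReal.ofReal (C * sumSeminorm s f) * phaseWeight z := by
  obtain ⟨s, C, hC, h⟩ := exists_stft_decay g (d + 1)
  refine ⟨s, C, hC, fun f z => ?_⟩
  rw [phaseWeight, weight, weight, ← ENNReal.ofReal_mul (by positivity),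
    ← ENNReal.ofReal_mul (mul_nonneg hC (sumSeminorm_nonneg _ _)), ← ofReal_norm]
  refine ENNReal.ofReal_le_ofReal ?_
  rw [← mul_inv, ← div_eq_mul_inv, le_div_iff₀ (by positivity)]
  exact h f z

theorem measurable_enorm_stft (g : 𝓢(RR d, ℂ)) (ψ : 𝓢'(RR d, ℂ)) :
    Measurable fun z => ‖stft g ψ z‖ₑ :=
  (continuous_stft g ψ).enorm.measurable

theorem mixedENorm_stft_coe_lt_top (g f : 𝓢(RR d, ℂ)) {p q : ℝ≥0∞} (hp : 1 ≤ p) (hq : 1 ≤ q) :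
    mixedENorm p q (fun z => ‖stft g (f : 𝓢'(RR d, ℂ)) z‖ₑ) < ∞ := by
  obtain ⟨s, C, -, h⟩ := exists_enorm_stft_coe_le_phaseWeight g
  refine ((mixedENorm_mono p q (h f)).trans
    (mixedENorm_const_mul hp hq measurable_phaseWeight _)).trans_lt ?_
  exact ENNReal.mul_lt_top ENNReal.ofReal_lt_top (mixedENorm_phaseWeight_lt_top hp hq)

theorem modNorm_eq_mixedENorm (g : 𝓢(RR d, ℂ)) (p q : ℝ≥0∞) (ψ : 𝓢'(RR d, ℂ)) :
    modNorm g p q ψ = mixedENorm p q fun z => ‖stft g ψ z‖ₑ := by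
  simp only [modNorm, mixedNorm, mixedENorm, eLpNorm_enorm]

/-- Every exponent `p ≥ 1` has a conjugate exponent. -/
theorem exists_conjExponent {p : ℝ≥0∞} (hp : 1 ≤ p) : ∃ p' : ℝ≥0∞, 1 ≤ p' ∧ p⁻¹ + p'⁻¹ = 1 := by
  have h1 : p⁻¹ ≤ 1 := ENNReal.inv_le_one.mpr hp
  refine ⟨(1 - p⁻¹)⁻¹, ?_, ?_⟩
  · rw [← ENNReal.inv_le_inv, inv_inv, inv_one]
    exact tsub_le_self
  · rw [inv_inv, add_tsub_cancel_of_le h1]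

/-- Elements of a modulation space have bounded short-time Fourier transforms, for all Schwartz
windows: `M^{p,q} ⊆ M^∞`. -/
theorem exists_enorm_stft_le_of_memMod {g : 𝓢(RR d, ℂ)} (hg : g ≠ 0) {p q : ℝ≥0∞} (hp : 1 ≤ p)
    (hq : 1 ≤ q) {ψ : 𝓢'(RR d, ℂ)} (hψ : MemMod g p q ψ) (h : 𝓢(RR d, ℂ)) :
    ∃ M : ℝ, ∀ z, ‖stft h ψ z‖ ≤ M := by
  obtain ⟨p', hp', hpp'⟩ := exists_conjExponent hp
  obtain ⟨q', hq', hqq'⟩ := exists_conjExponent hq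
  set K : ℝ≥0∞ := windowConst g * (modNorm g p q ψ *
    mixedENorm p' q' (fun z => ‖stft g (h : 𝓢'(RR d, ℂ)) z‖ₑ)) with hK
  have hKt : K < ∞ := ENNReal.mul_lt_top (windowConst_lt_top g)
    (ENNReal.mul_lt_top hψ (mixedENorm_stft_coe_lt_top g h hp' hq'))
  refine ⟨K.toReal, fun z => ?_⟩
  rw [← toReal_enorm]
  refine ENNReal.toReal_mono hKt.ne ((enorm_stft_le hg h ψ z).trans ?_)
  rw [hK, modNorm_eq_mixedENorm,
    ← mixedENorm_sub_right p' q' (measurable_enorm_stft g (h : 𝓢'(RR d, ℂ))) z]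
  gcongr
  exact lintegral_mul_le_mixedENorm_mul_mixedENorm hpp' hqq' (measurable_enorm_stft g ψ)
    ((measurable_enorm_stft g (h : 𝓢'(RR d, ℂ))).comp (measurable_sub_const z))

/-- Elements of `M¹` have integrable short-time Fourier transforms, for all Schwartz windows. -/
theorem integrable_stft_of_memMod {g : 𝓢(RR d, ℂ)} (hg : g ≠ 0) {φ : 𝓢'(RR d, ℂ)}
    (hφ : MemMod g 1 1 φ) (h : 𝓢(RR d, ℂ)) : Integrable (stft h φ) := by
  refine ⟨(continuous_stft h φ).aestronglyMeasurable, ?_⟩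
  have hm := measurable_enorm_stft g φ
  have hm' := measurable_enorm_stft g (h : 𝓢'(RR d, ℂ))
  have hφ' : ∫⁻ w, ‖stft g φ w‖ₑ < ∞ := by
    rw [← mixedENorm_one_one hm, ← modNorm_eq_mixedENorm]; exact hφ
  have hh : ∫⁻ w, ‖stft g (h : 𝓢'(RR d, ℂ)) w‖ₑ < ∞ := by
    rw [← mixedENorm_one_one hm']; exact mixedENorm_stft_coe_lt_top g h le_rfl le_rfl
  have hmj : Measurable fun p : (RR d × RR d) × (RR d × RR d) =>
      ‖stft g φ p.2‖ₑ * ‖stft g (h : 𝓢'(RR d, ℂ)) (p.2 - p.1)‖ₑ :=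
    (hm.comp measurable_snd).mul (hm'.comp (measurable_snd.sub measurable_fst))
  calc ∫⁻ z, ‖stft h φ z‖ₑ
      ≤ ∫⁻ z, windowConst g * ∫⁻ w, ‖stft g φ w‖ₑ * ‖stft g (h : 𝓢'(RR d, ℂ)) (w - z)‖ₑ :=
        lintegral_mono fun z => enorm_stft_le hg h φ z
    _ = windowConst g *
          ∫⁻ w, ∫⁻ z, ‖stft g φ w‖ₑ * ‖stft g (h : 𝓢'(RR d, ℂ)) (w - z)‖ₑ := by
        rw [lintegral_const_mul _ hmj.lintegral_prod_right',
          lintegral_lintegral_swap hmj.aemeasurable]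
    _ = windowConst g *
          ((∫⁻ w, ‖stft g φ w‖ₑ) * ∫⁻ w, ‖stft g (h : 𝓢'(RR d, ℂ)) w‖ₑ) := by
        rw [← lintegral_mul_const _ hm]
        congr 1
        refine lintegral_congr fun w => ?_
        have hmw : Measurable fun z => ‖stft g (h : 𝓢'(RR d, ℂ)) (w - z)‖ₑ :=
          hm'.comp (measurable_const_sub w)
        rw [lintegral_const_mul _ hmw,
          lintegral_sub_left_eq_self (fun z => ‖stft g (h : 𝓢'(RR d, ℂ)) z‖ₑ) w]
    _ < ∞ := ENNReal.mul_lt_top (windowConst_lt_top g) (ENNReal.mul_lt_top hφ' hh)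

/-! ### The duality pairing -/

theorem integrable_stft_shiftD {h : 𝓢(RR d, ℂ)} {φ : 𝓢'(RR d, ℂ)} (hφ : Integrable (stft h φ))
    (z : RR d × RR d) : Integrable (stft h (shiftD z φ)) := by
  refine (hφ.comp_sub_right z).norm.mono' (continuous_stft h _).aestronglyMeasurable
    (Filter.Eventually.of_forall fun w => ?_)
  rw [norm_stft_shiftD]

theorem integrable_pairingIntegrand {h : 𝓢(RR d, ℂ)} {ψ u : 𝓢'(RR d, ℂ)} {M : ℝ}
    (hψ : ∀ z, ‖stft h ψ z‖ ≤ M) (hu : Integrable (stft h u)) :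
    Integrable (pairingIntegrand h ψ u) := by
  refine (hu.norm.const_mul M).mono' (Continuous.aestronglyMeasurable
    ((continuous_stft h ψ).mul (Complex.continuous_conj.comp (continuous_stft h u))))
    (Filter.Eventually.of_forall fun w => ?_)
  rw [pairingIntegrand, norm_mul, RCLike.norm_conj]
  exact mul_le_mul_of_nonneg_right (hψ w) (norm_nonneg _)

/-- The double integral that compares two windows for the duality pairing converges absolutely. -/
theorem integrable_pairingKernel (g h : 𝓢(RR d, ℂ)) {ψ u : 𝓢'(RR d, ℂ)}
    {M : ℝ} (hψ : ∀ z, ‖stft g ψ z‖ ≤ M) (hu : Integrable (stft h u)) :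
    Integrable (fun p : (RR d × RR d) × (RR d × RR d) =>
      stft g ψ p.1 * conj (stft g (shift p.2 h : 𝓢'(RR d, ℂ)) p.1) * conj (stft h u p.2))
      (volume.prod volume) := by
  have hgh : Integrable (stft g (h : 𝓢'(RR d, ℂ))) := by
    have := integrable_norm_stft_mul_pow g h 0
    simp only [pow_zero, mul_one] at this
    exact (integrable_norm_iff (continuous_stft g _).aestronglyMeasurable).mp this
  have h1 := (hu.norm.convolution_integrand (ContinuousLinearMap.mul ℝ ℝ) hgh.norm).const_mul M
  have hc : Continuous fun p : (RR d × RR d) × (RR d × RR d) =>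
      stft g (shift p.2 h : 𝓢'(RR d, ℂ)) p.1 := by
    simp_rw [← shiftD_coe]
    exact (continuous_stft_shiftD g (h : 𝓢'(RR d, ℂ))).comp
      (f := fun p : (RR d × RR d) × (RR d × RR d) => (p.2, p.1)) (by fun_prop)
  have hcψ : Continuous fun p : (RR d × RR d) × (RR d × RR d) => stft g ψ p.1 :=
    (continuous_stft g ψ).comp continuous_fst
  have hcu : Continuous fun p : (RR d × RR d) × (RR d × RR d) => stft h u p.2 :=
    (continuous_stft h u).comp continuous_snd
  refine h1.mono' ((hcψ.mul hc.star).mul hcu.star).aestronglyMeasurable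
    (Filter.Eventually.of_forall fun p => ?_)
  rw [norm_mul, norm_mul, RCLike.norm_conj, RCLike.norm_conj, ContinuousLinearMap.mul_apply',
    ← shiftD_coe, norm_stft_shiftD, mul_assoc, mul_comm ‖stft h u p.2‖]
  exact mul_le_mul_of_nonneg_right (hψ p.1) (by positivity)

/-- The duality pairing does not depend on the window with which it is computed: inserting the
inversion formula for `ψ` with respect to `g`, Fubini's theorem leaves the inversion formula for `u`
with respect to `h`. -/
theorem pairing_eq_pairing {g h : 𝓢(RR d, ℂ)} (hg : g ≠ 0) (hh : h ≠ 0) {ψ u : 𝓢'(RR d, ℂ)}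
    {M : ℝ} (hψ : ∀ z, ‖stft g ψ z‖ ≤ M) (hu : Integrable (stft h u)) :
    pairing h ψ u = pairing g ψ u := by
  have e1 : ∀ w, windowSq g * pairingIntegrand h ψ u w =
      ∫ v, stft g ψ v * conj (stft g (shift w h : 𝓢'(RR d, ℂ)) v) * conj (stft h u w) := fun w => by
    rw [integral_mul_const, integral_stft_mul_conj_stft g (shift w h) ψ, pairingIntegrand,
      ← mul_assoc]
    rfl
  have e2 : ∀ v, ∫ w, stft g ψ v * conj (stft g (shift w h : 𝓢'(RR d, ℂ)) v) * conj (stft h u w) =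
      windowSq h * pairingIntegrand g ψ u v := fun v => by
    have h1 : ∀ w, stft g ψ v * conj (stft g (shift w h : 𝓢'(RR d, ℂ)) v) * conj (stft h u w) =
        stft g ψ v * conj (stft h u w * conj (stft h (shift v g : 𝓢'(RR d, ℂ)) w)) := fun w => by
      rw [stft_shift_symm, map_mul, Complex.conj_conj]
      ring
    have h2 := integral_stft_mul_conj_stft h (shift v g) u
    rw [← windowSq] at h2
    simp_rw [h1]
    rw [integral_const_mul, integral_conj, h2, map_mul, conj_windowSq, pairingIntegrand]
    change _ * (_ * conj (stft g u v)) = _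
    ring
  have key : windowSq g * ∫ w, pairingIntegrand h ψ u w =
      windowSq h * ∫ v, pairingIntegrand g ψ u v := by
    rw [← integral_const_mul, ← integral_const_mul]
    simp_rw [e1, ← e2]
    exact (integral_integral_swap (integrable_pairingKernel g h hψ hu)).symm
  have hg0 := windowSq_ne_zero hg
  have hh0 := windowSq_ne_zero hh
  change (windowSq h)⁻¹ * _ = (windowSq g)⁻¹ * _
  rw [inv_mul_eq_iff_eq_mul₀ hh0, mul_left_comm, eq_inv_mul_iff_mul_eq₀ hg0]
  exact key

/-! ### The analysis map `ψ ↦ V_φ ψ` for a window in `M¹` -/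

theorem inv_add_inv_one_eq (p : ℝ≥0∞) : p⁻¹ + (1 : ℝ≥0∞)⁻¹ = 1 + p⁻¹ := by
  rw [inv_one, add_comm]

/-- The transform `V_φ ψ` does not depend on the Schwartz window with which the pairing is
computed. -/
theorem stftM_eq_stftM {g h : 𝓢(RR d, ℂ)} (hg : g ≠ 0) (hh : h ≠ 0) {φ : 𝓢'(RR d, ℂ)}
    (hφ : MemMod g 1 1 φ) {p q : ℝ≥0∞} (hp : 1 ≤ p) (hq : 1 ≤ q) {ψ : 𝓢'(RR d, ℂ)}
    (hψ : MemMod g p q ψ) : stftM h φ ψ = stftM g φ ψ := by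
  obtain ⟨M, hM⟩ := exists_enorm_stft_le_of_memMod hg hp hq hψ g
  funext z
  exact pairing_eq_pairing hg hh hM (integrable_stft_shiftD (integrable_stft_of_memMod hg hφ h) z)

theorem stronglyMeasurable_stftM (g : 𝓢(RR d, ℂ)) (φ ψ : 𝓢'(RR d, ℂ)) :
    StronglyMeasurable (stftM g φ ψ) := by
  have hc : Continuous fun p : (RR d × RR d) × (RR d × RR d) =>
      pairingIntegrand g ψ (shiftD p.1 φ) p.2 :=
    ((continuous_stft g ψ).comp continuous_snd).mul (continuous_stft_shiftD g φ).star
  exact hc.stronglyMeasurable.integral_prod_right'.const_mul _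

/-- Covariance turns the duality pairing with `π(z) φ` into a convolution of short-time Fourier
transforms with a Schwartz window. -/
theorem enorm_stftM_le (g : 𝓢(RR d, ℂ)) (φ ψ : 𝓢'(RR d, ℂ)) (z : RR d × RR d) :
    ‖stftM g φ ψ z‖ₑ ≤ windowConst g *
      ((fun w => ‖stft g ψ w‖ₑ) ⋆ₗ[volume] fun w => ‖stft g φ (-w)‖ₑ) z := by
  rw [stftM, pairing, enorm_mul, lconvolution_def]
  refine mul_le_mul_right ((enorm_integral_le_lintegral_enorm _).trans_eq ?_) _
  refine lintegral_congr fun w => ?_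
  rw [pairingIntegrand, enorm_mul, RCLike.enorm_conj, enorm_stft_shiftD, neg_add, neg_neg,
    ← sub_eq_add_neg]

theorem mixedENorm_stftM_le (g : 𝓢(RR d, ℂ)) (φ ψ : 𝓢'(RR d, ℂ)) {p q : ℝ≥0∞} (hp : 1 ≤ p)
    (hq : 1 ≤ q) :
    mixedENorm p q (fun z => ‖stftM g φ ψ z‖ₑ) ≤
      windowConst g * (modNorm g p q ψ * modNorm g 1 1 φ) := by
  have hmψ := measurable_enorm_stft g ψ
  have hmφ := measurable_enorm_stft g φ
  have hmn : Measurable fun w => ‖stft g φ (-w)‖ₑ := hmφ.comp measurable_neg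
  refine (mixedENorm_mono p q (enorm_stftM_le g φ ψ)).trans
    ((mixedENorm_const_mul hp hq (measurable_lconvolution volume hmψ hmn) _).trans ?_)
  refine mul_le_mul_right ?_ _
  rw [modNorm_eq_mixedENorm, modNorm_eq_mixedENorm, ← mixedENorm_neg 1 1 hmφ]
  exact mixedENorm_lconvolution_le hp hq le_rfl le_rfl hp hq (inv_add_inv_one_eq p)
    (inv_add_inv_one_eq q) hmψ hmn

/-! ### The convolution with the symbol -/

theorem enorm_convolution_mul_le {G : Type*} [AddCommGroup G] [MeasurableSpace G] (μ : Measure G)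
    (f k : G → ℂ) (z : G) :
    ‖(f ⋆[ContinuousLinearMap.mul ℂ ℂ, μ] k) z‖ₑ ≤
      ((fun w => ‖f w‖ₑ) ⋆ₗ[μ] fun w => ‖k w‖ₑ) z := by
  rw [convolution_def, lconvolution_def]
  refine (enorm_integral_le_lintegral_enorm _).trans_eq (lintegral_congr fun w => ?_)
  rw [ContinuousLinearMap.mul_apply', enorm_mul, neg_add_eq_sub]

theorem convolutionExistsAt_of_lconvolution_lt_top {G : Type*} [AddCommGroup G] [MeasurableSpace G]
    [MeasurableAdd₂ G] [MeasurableNeg G] {μ : Measure G} {f k : G → ℂ} (hf : StronglyMeasurable f)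
    (hk : StronglyMeasurable k) {z : G}
    (h : ((fun w => ‖f w‖ₑ) ⋆ₗ[μ] fun w => ‖k w‖ₑ) z < ∞) :
    ConvolutionExistsAt f k z (ContinuousLinearMap.mul ℂ ℂ) μ := by
  have hs : Measurable fun w : G => z - w := by
    simpa only [sub_eq_add_neg] using measurable_neg.const_add z
  refine ⟨(hf.mul (hk.comp_measurable hs)).aestronglyMeasurable, ?_⟩
  refine lt_of_eq_of_lt (lintegral_congr fun w => ?_) h
  beta_reduce
  rw [ContinuousLinearMap.mul_apply', enorm_mul, neg_add_eq_sub]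

theorem stronglyMeasurable_blurredStft (g : 𝓢(RR d, ℂ)) {μ : RR d × RR d → ℂ}
    (hμ : StronglyMeasurable μ) (φ ψ : 𝓢'(RR d, ℂ)) :
    StronglyMeasurable (blurredStft g μ φ ψ) := by
  have hs : StronglyMeasurable fun p : (RR d × RR d) × (RR d × RR d) =>
      μ p.2 * stftM g φ ψ (p.1 - p.2) :=
    (hμ.comp_measurable measurable_snd).mul
      ((stronglyMeasurable_stftM g φ ψ).comp_measurable (measurable_fst.sub measurable_snd))
  exact hs.integral_prod_right'

theorem mixedNorm_eq_mixedENorm (p q : ℝ≥0∞) (F : RR d × RR d → ℂ) :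
    mixedNorm p q F = mixedENorm p q fun z => ‖F z‖ₑ := by
  simp only [mixedNorm, mixedENorm, eLpNorm_enorm]

/-! ### The synthesis map `K ↦ ∫ K(z) π(z) φ dz` -/

/-- Tonelli's theorem: convolution with `A` is dual to correlation with `A`. -/
theorem lintegral_lconvolution_mul {G : Type*} [AddCommGroup G] [MeasurableSpace G]
    [MeasurableAdd₂ G] [MeasurableNeg G] {μ : Measure G} [SFinite μ] {F A H : G → ℝ≥0∞}
    (hF : Measurable F) (hA : Measurable A) (hH : Measurable H) :
    ∫⁻ v, (F ⋆ₗ[μ] A) v * H v ∂μ = ∫⁻ z, F z * ∫⁻ v, A (v - z) * H v ∂μ ∂μ := by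
  have hs : Measurable fun p : G × G => -p.2 + p.1 := measurable_snd.neg.add measurable_fst
  have hAH : ∀ z, Measurable fun v => A (-z + v) * H v := fun z =>
    (hA.comp (measurable_const_add (-z))).mul hH
  have hFA : ∀ v, Measurable fun z => F z * A (-z + v) := fun v =>
    hF.mul (hA.comp (measurable_neg.add_const v))
  have hm : Measurable fun p : G × G => F p.2 * A (-p.2 + p.1) * H p.1 :=
    ((hF.comp measurable_snd).mul (hA.comp hs)).mul (hH.comp measurable_fst)
  have h1 : ∀ v, (F ⋆ₗ[μ] A) v * H v = ∫⁻ z, F z * A (-z + v) * H v ∂μ := fun v => by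
    rw [lconvolution_def, lintegral_mul_const _ (hFA v)]
  simp_rw [h1]
  rw [lintegral_lintegral_swap hm.aemeasurable]
  refine lintegral_congr fun z => ?_
  simp_rw [mul_assoc]
  rw [lintegral_const_mul _ (hAH z)]
  simp_rw [neg_add_eq_sub]

/-- The inversion formula for `π(z) φ`: its values on a test function are dominated by a convolution
in the variable `z`. -/
theorem enorm_shiftD_apply_le {g : 𝓢(RR d, ℂ)} (hg : g ≠ 0) (φ : 𝓢'(RR d, ℂ)) (f : 𝓢(RR d, ℂ))
    (z : RR d × RR d) :
    ‖shiftD z φ f‖ₑ ≤ windowConst g *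
      ∫⁻ w, ‖stft g φ (w - z)‖ₑ * ‖stft g (conjS f : 𝓢'(RR d, ℂ)) w‖ₑ := by
  have h := enorm_apply_conjS_le hg (shiftD z φ) (conjS f)
  simpa only [conjS_conjS, enorm_stft_shiftD] using h

/-- The weak integral `∫ K(z) π(z) φ dz` converges absolutely, with a bound by a seminorm of the
test function: by duality with `M^{r',s'}`, which contains the Schwartz functions. -/
theorem exists_lintegral_synthesis_le {g : 𝓢(RR d, ℂ)} (hg : g ≠ 0) {φ : 𝓢'(RR d, ℂ)}
    (hφ : MemMod g 1 1 φ) {r₁ r₂ : ℝ≥0∞} (hr₁ : 1 ≤ r₁) (hr₂ : 1 ≤ r₂) {K : RR d × RR d → ℂ}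
    (hK : StronglyMeasurable K) (hKr : mixedENorm r₁ r₂ (fun z => ‖K z‖ₑ) < ∞) :
    ∃ (s : Finset (ℕ × ℕ)) (C : ℝ), 0 ≤ C ∧ ∀ f : 𝓢(RR d, ℂ),
      ∫⁻ z, ‖K z * shiftD z φ f‖ₑ ≤ ENNReal.ofReal (C * sumSeminorm s f) := by
  obtain ⟨t₁, ht₁, hrt₁⟩ := exists_conjExponent hr₁
  obtain ⟨t₂, ht₂, hrt₂⟩ := exists_conjExponent hr₂
  obtain ⟨s, C, hC, hsC⟩ := exists_enorm_stft_coe_le_phaseWeight g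
  have hmK : Measurable fun z => ‖K z‖ₑ := hK.enorm
  have hmφ := measurable_enorm_stft g φ
  set N : ℝ≥0∞ := mixedENorm r₁ r₂ ((fun z => ‖K z‖ₑ) ⋆ₗ[volume] fun z => ‖stft g φ z‖ₑ) with hN
  have hNt : N < ∞ := by
    refine (mixedENorm_lconvolution_le hr₁ hr₂ le_rfl le_rfl hr₁ hr₂ (inv_add_inv_one_eq r₁)
      (inv_add_inv_one_eq r₂) hmK hmφ).trans_lt (ENNReal.mul_lt_top hKr ?_)
    rw [← modNorm_eq_mixedENorm]
    exact hφ
  set T : ℝ≥0∞ := windowConst g * (N * mixedENorm t₁ t₂ (phaseWeight (d := d))) with hT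
  have hTt : T < ∞ := ENNReal.mul_lt_top (windowConst_lt_top g)
    (ENNReal.mul_lt_top hNt (mixedENorm_phaseWeight_lt_top ht₁ ht₂))
  refine ⟨s, T.toReal * C, by positivity, fun f => ?_⟩
  have hmf := measurable_enorm_stft g (conjS f : 𝓢'(RR d, ℂ))
  have hmKI : Measurable fun z => ‖K z‖ₑ * ∫⁻ w, ‖stft g φ (w - z)‖ₑ *
      ‖stft g (conjS f : 𝓢'(RR d, ℂ)) w‖ₑ :=
    hmK.mul <| Measurable.lintegral_prod_right' (f := fun p : (RR d × RR d) × (RR d × RR d) =>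
      ‖stft g φ (p.2 - p.1)‖ₑ * ‖stft g (conjS f : 𝓢'(RR d, ℂ)) p.2‖ₑ)
      ((hmφ.comp (measurable_snd.sub measurable_fst)).mul (hmf.comp measurable_snd))
  have hf : mixedENorm t₁ t₂ (fun z => ‖stft g (conjS f : 𝓢'(RR d, ℂ)) z‖ₑ) ≤
      ENNReal.ofReal (C * sumSeminorm s f) * mixedENorm t₁ t₂ (phaseWeight (d := d)) := by
    refine (mixedENorm_mono t₁ t₂ fun z => (hsC (conjS f) z).trans ?_).trans
      (mixedENorm_const_mul ht₁ ht₂ measurable_phaseWeight _)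
    gcongr
    exact sumSeminorm_conjS s f
  calc ∫⁻ z, ‖K z * shiftD z φ f‖ₑ
      ≤ ∫⁻ z, windowConst g * (‖K z‖ₑ * ∫⁻ w, ‖stft g φ (w - z)‖ₑ *
          ‖stft g (conjS f : 𝓢'(RR d, ℂ)) w‖ₑ) := by
        refine lintegral_mono fun z => ?_
        rw [enorm_mul, mul_left_comm]
        gcongr
        exact enorm_shiftD_apply_le hg φ f z
    _ = windowConst g * ∫⁻ v, ((fun z => ‖K z‖ₑ) ⋆ₗ[volume] fun z => ‖stft g φ z‖ₑ) v *
          ‖stft g (conjS f : 𝓢'(RR d, ℂ)) v‖ₑ := by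
        rw [lintegral_const_mul _ hmKI, lintegral_lconvolution_mul hmK hmφ hmf]
    _ ≤ windowConst g * (N * (ENNReal.ofReal (C * sumSeminorm s f) *
          mixedENorm t₁ t₂ (phaseWeight (d := d)))) := by
        refine mul_le_mul_right ?_ _
        refine (lintegral_mul_le_mixedENorm_mul_mixedENorm hrt₁ hrt₂
          (measurable_lconvolution volume hmK hmφ) hmf).trans ?_
        exact mul_le_mul_right hf _
    _ = T * ENNReal.ofReal (C * sumSeminorm s f) := by rw [hT]; ring
    _ = ENNReal.ofReal (T.toReal * C * sumSeminorm s f) := by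
        rw [mul_assoc T.toReal, ENNReal.ofReal_mul ENNReal.toReal_nonneg,
          ENNReal.ofReal_toReal hTt.ne]

/-- Synthesis with a window in `M¹` maps `L^{r₁,r₂}` boundedly to `M^{r₁,r₂}`. -/
theorem exists_synthesis {g : 𝓢(RR d, ℂ)} (hg : g ≠ 0) {φ : 𝓢'(RR d, ℂ)}
    (hφ : MemMod g 1 1 φ) {r₁ r₂ : ℝ≥0∞} (hr₁ : 1 ≤ r₁) (hr₂ : 1 ≤ r₂) {K : RR d × RR d → ℂ}
    (hK : StronglyMeasurable K) (hKr : mixedENorm r₁ r₂ (fun z => ‖K z‖ₑ) < ∞) :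
    ∃ B : 𝓢'(RR d, ℂ),
      (∀ f : 𝓢(RR d, ℂ), Integrable (fun z => K z * shiftD z φ f)) ∧
      (∀ f : 𝓢(RR d, ℂ), B f = ∫ z, K z * shiftD z φ f) ∧
      modNorm g r₁ r₂ B ≤ mixedENorm r₁ r₂ (fun z => ‖K z‖ₑ) * modNorm g 1 1 φ := by
  obtain ⟨s, C, hC, hb⟩ := exists_lintegral_synthesis_le hg hφ hr₁ hr₂ hK hKr
  have hint : ∀ f : 𝓢(RR d, ℂ), Integrable (fun z => K z * shiftD z φ f) := fun f =>
    ⟨(hK.mul (continuous_shiftD_apply φ f).stronglyMeasurable).aestronglyMeasurable,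
      (hb f).trans_lt ENNReal.ofReal_lt_top⟩
  have hadd : ∀ (z : RR d × RR d) (f₁ f₂ : 𝓢(RR d, ℂ)),
      shiftD z φ (f₁ + f₂) = shiftD z φ f₁ + shiftD z φ f₂ := fun z f₁ f₂ =>
    map_add (shiftD z φ : 𝓢(RR d, ℂ) →L[ℂ] ℂ) f₁ f₂
  let B : 𝓢(RR d, ℂ) →L[ℂ] ℂ := SchwartzMap.mkCLMtoNormedSpace (D := RR d) (E := ℂ)
    (σ := RingHom.id ℂ) (fun f => ∫ z, K z * shiftD z φ f)
    (fun f₁ f₂ => by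
      simp_rw [hadd, mul_add]
      exact integral_add (hint f₁) (hint f₂))
    (fun a f => by
      simp_rw [distribution_smul, mul_left_comm _ a]
      exact integral_const_mul _ _)
    ⟨s, C * s.card, by positivity, fun f => by
      have h1 : ‖∫ z, K z * shiftD z φ f‖ ≤ C * sumSeminorm s f := by
        refine (norm_integral_le_lintegral_norm _).trans ?_
        simp_rw [ofReal_norm]
        exact ENNReal.toReal_le_of_le_ofReal (mul_nonneg hC (sumSeminorm_nonneg s f)) (hb f)
      refine h1.trans ?_
      rw [mul_assoc, ← nsmul_eq_mul]
      refine mul_le_mul_of_nonneg_left (Finset.sum_le_card_nsmul _ _ _ fun i hi => ?_) hC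
      exact Seminorm.le_def.mp (Finset.le_sup (f := schwartzSeminormFamily ℂ (RR d) ℂ) hi) f⟩
  let B' : 𝓢'(RR d, ℂ) := ContinuousLinearMap.toPointwiseConvergenceCLM _ _ _ _ B
  have hB : ∀ f : 𝓢(RR d, ℂ), B' f = ∫ z, K z * shiftD z φ f := fun f => rfl
  refine ⟨B', hint, hB, ?_⟩
  have hle : ∀ z, ‖stft g B' z‖ₑ ≤
      ((fun w => ‖K w‖ₑ) ⋆ₗ[volume] fun w => ‖stft g φ w‖ₑ) z := fun z => by
    rw [stft, hB, lconvolution_def]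
    refine (enorm_integral_le_lintegral_enorm _).trans_eq (lintegral_congr fun w => ?_)
    rw [enorm_mul, ← stft, enorm_stft_shiftD, neg_add_eq_sub]
  rw [modNorm_eq_mixedENorm, modNorm_eq_mixedENorm]
  exact (mixedENorm_mono r₁ r₂ hle).trans
    (mixedENorm_lconvolution_le hr₁ hr₂ le_rfl le_rfl hr₁ hr₂ (inv_add_inv_one_eq r₁)
      (inv_add_inv_one_eq r₂) hK.enorm (measurable_enorm_stft g φ))

/-! ### Blurring operators -/

theorem blurredStft_congr {μ ν : RR d × RR d → ℂ} (hμν : μ =ᵐ[volume] ν) (h : 𝓢(RR d, ℂ))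
    (φ ψ : 𝓢'(RR d, ℂ)) : blurredStft h μ φ ψ = blurredStft h ν φ ψ := by
  funext z
  refine integral_congr_ae ?_
  filter_upwards [hμν] with w hw
  rw [hw]

/-- Blurring depends only on the almost everywhere class of the symbol. -/
theorem IsBlur.congr {μ ν : RR d × RR d → ℂ} (hμν : μ =ᵐ[volume] ν) {h : 𝓢(RR d, ℂ)}
    {φ ψ B : 𝓢'(RR d, ℂ)} (hB : IsBlur h μ φ ψ B) : IsBlur h ν φ ψ B where
  pairing_integrable := hB.pairing_integrable
  convolution_exists := hB.convolution_exists.mono fun z hz => by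
    refine Integrable.congr hz ?_
    filter_upwards [hμν] with w hw
    rw [hw]
  synthesis_integrable := by
    simpa only [blurredStft_congr hμν] using hB.synthesis_integrable
  apply_eq := by
    simpa only [blurredStft_congr hμν] using hB.apply_eq

/-- Existence and boundedness of `B_μ^φ ψ` for a measurable symbol, with constant `‖g‖⁻² ‖φ‖²`. The
convolution `|μ| * |V_φ ψ|` dominates the convolution that enters `B`, and it has finite mixed norm,
so it is finite almost everywhere. -/
theorem exists_isBlur_of_stronglyMeasurable {p₁ p₂ q₁ q₂ r₁ r₂ : ℝ≥0∞}
    (hp₁ : 1 ≤ p₁) (hp₂ : 1 ≤ p₂) (hq₁ : 1 ≤ q₁) (hq₂ : 1 ≤ q₂) (hr₁ : 1 ≤ r₁) (hr₂ : 1 ≤ r₂)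
    (h₁ : p₁⁻¹ + q₁⁻¹ = 1 + r₁⁻¹) (h₂ : p₂⁻¹ + q₂⁻¹ = 1 + r₂⁻¹)
    {g : 𝓢(RR d, ℂ)} (hg : g ≠ 0) {φ : 𝓢'(RR d, ℂ)} (hφ : MemMod g 1 1 φ)
    {μ : RR d × RR d → ℂ} (hμm : StronglyMeasurable μ) (hμ : mixedNorm p₁ p₂ μ < ∞)
    {ψ : 𝓢'(RR d, ℂ)} (hψ : MemMod g q₁ q₂ ψ) :
    ∃ B : 𝓢'(RR d, ℂ), (∀ h : 𝓢(RR d, ℂ), h ≠ 0 → IsBlur h μ φ ψ B) ∧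
      modNorm g r₁ r₂ B ≤ windowConst g * modNorm g 1 1 φ * modNorm g 1 1 φ *
        mixedNorm p₁ p₂ μ * modNorm g q₁ q₂ ψ := by
  have hVm := stronglyMeasurable_stftM g φ ψ
  have hV := mixedENorm_stftM_le g φ ψ hq₁ hq₂
  set Q : RR d × RR d → ℝ≥0∞ :=
    (fun w => ‖μ w‖ₑ) ⋆ₗ[volume] fun w => ‖stftM g φ ψ w‖ₑ with hQ
  have hQm : Measurable Q := measurable_lconvolution volume hμm.enorm hVm.enorm
  have hQle : mixedENorm r₁ r₂ Q ≤
      mixedNorm p₁ p₂ μ * (windowConst g * (modNorm g q₁ q₂ ψ * modNorm g 1 1 φ)) := by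
    refine (mixedENorm_lconvolution_le hp₁ hp₂ hq₁ hq₂ hr₁ hr₂ h₁ h₂ hμm.enorm hVm.enorm).trans ?_
    rw [mixedNorm_eq_mixedENorm]
    gcongr
  have hQt : mixedENorm r₁ r₂ Q < ∞ := hQle.trans_lt (ENNReal.mul_lt_top hμ
    (ENNReal.mul_lt_top (windowConst_lt_top g) (ENNReal.mul_lt_top hψ hφ)))
  have hKQ : mixedENorm r₁ r₂ (fun z => ‖blurredStft g μ φ ψ z‖ₑ) ≤ mixedENorm r₁ r₂ Q :=
    mixedENorm_mono r₁ r₂ fun z => enorm_convolution_mul_le volume μ (stftM g φ ψ) z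
  obtain ⟨B, hBi, hB, hBn⟩ := exists_synthesis hg hφ hr₁ hr₂
    (stronglyMeasurable_blurredStft g hμm φ ψ) (hKQ.trans_lt hQt)
  refine ⟨B, fun h hh => ?_, ?_⟩
  · have hVh : stftM h φ ψ = stftM g φ ψ := stftM_eq_stftM hg hh hφ hq₁ hq₂ hψ
    have hKh : blurredStft h μ φ ψ = blurredStft g μ φ ψ := by rw [blurredStft, hVh, blurredStft]
    refine ⟨fun z => ?_, ?_, fun f => by rw [hKh]; exact hBi f, fun f => by rw [hKh]; exact hB f⟩
    · obtain ⟨M, hM⟩ := exists_enorm_stft_le_of_memMod hg hq₁ hq₂ hψ h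
      exact integrable_pairingIntegrand hM
        (integrable_stft_shiftD (integrable_stft_of_memMod hg hφ h) z)
    · rw [hVh]
      filter_upwards [ae_lt_top_of_mixedENorm_lt_top hr₁ hr₂ hQm hQt] with z hz
      exact convolutionExistsAt_of_lconvolution_lt_top hμm hVm hz
  · calc modNorm g r₁ r₂ B
        ≤ mixedNorm p₁ p₂ μ * (windowConst g * (modNorm g q₁ q₂ ψ * modNorm g 1 1 φ)) *
            modNorm g 1 1 φ := hBn.trans (mul_le_mul_left (hKQ.trans hQle) _)
      _ = _ := by ring

end TFBlur

end

theorem mainTheorem3 (d : ℕ) (p₁ p₂ q₁ q₂ r₁ r₂ : ℝ≥0∞)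
    (hp₁ : 1 ≤ p₁) (hp₂ : 1 ≤ p₂) (hq₁ : 1 ≤ q₁) (hq₂ : 1 ≤ q₂) (hr₁ : 1 ≤ r₁) (hr₂ : 1 ≤ r₂)
    (h₁ : p₁⁻¹ + q₁⁻¹ = 1 + r₁⁻¹) (h₂ : p₂⁻¹ + q₂⁻¹ = 1 + r₂⁻¹)
    (g : 𝓢(TFBlur.RR d, ℂ)) (hg : g ≠ 0)
    (φ : 𝓢'(TFBlur.RR d, ℂ)) (hφ : TFBlur.MemMod g 1 1 φ) :
    ∃ C : ℝ≥0, ∀ μ : TFBlur.RR d × TFBlur.RR d → ℂ, TFBlur.MemMixed p₁ p₂ μ →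
      ∀ ψ : 𝓢'(TFBlur.RR d, ℂ), TFBlur.MemMod g q₁ q₂ ψ →
        ∃ B : 𝓢'(TFBlur.RR d, ℂ),
          (∀ h : 𝓢(TFBlur.RR d, ℂ), h ≠ 0 → TFBlur.IsBlur h μ φ ψ B) ∧
          TFBlur.MemMod g r₁ r₂ B ∧
          TFBlur.modNorm g r₁ r₂ B ≤
            C * TFBlur.mixedNorm p₁ p₂ μ * TFBlur.modNorm g q₁ q₂ ψ := by
  have hC : TFBlur.windowConst g * TFBlur.modNorm g 1 1 φ * TFBlur.modNorm g 1 1 φ < ∞ :=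
    ENNReal.mul_lt_top (ENNReal.mul_lt_top (TFBlur.windowConst_lt_top g) hφ) hφ
  refine ⟨(TFBlur.windowConst g * TFBlur.modNorm g 1 1 φ * TFBlur.modNorm g 1 1 φ).toNNReal,
    fun μ hμ ψ hψ => ?_⟩
  obtain ⟨hμm, hμn⟩ := hμ
  -- The symbol is only almost everywhere measurable: pass to a measurable representative.
  have hae : μ =ᵐ[volume] hμm.mk μ := hμm.ae_eq_mk
  have hnorm : TFBlur.mixedNorm p₁ p₂ (hμm.mk μ) = TFBlur.mixedNorm p₁ p₂ μ := by
    rw [TFBlur.mixedNorm_eq_mixedENorm, TFBlur.mixedNorm_eq_mixedENorm]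
    exact TFBlur.mixedENorm_congr_ae p₁ p₂ (hae.mono fun z hz => by rw [hz])
  obtain ⟨B, hB, hBn⟩ := TFBlur.exists_isBlur_of_stronglyMeasurable hp₁ hp₂ hq₁ hq₂ hr₁ hr₂ h₁ h₂
    hg hφ hμm.stronglyMeasurable_mk (hnorm.trans_lt hμn) hψ
  rw [hnorm] at hBn
  rw [ENNReal.coe_toNNReal hC.ne]
  exact ⟨B, fun h hh => (hB h hh).congr hae.symm,
    hBn.trans_lt (ENNReal.mul_lt_top (ENNReal.mul_lt_top hC hμn) hψ), hBn⟩
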